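/- All Banach spaces are real. Let $X$ be an infinite-dimensional Banach space with an unconditional Schauder basis $(e_n)_{n\ge 1}$ with biorthogonal functionals $(e_n^*)$, i.e. every $x\in X$ is the sum of the unconditionally convergent series $\sum_n e_n^*(x)e_n$. The basis is *shrinking* if $\overline{\mathrm{span}}\{e_n^*\}=X^*$, and *boundedly complete* if $\sum_n a_ne_n$ converges whenever $(a_n)$ is a sequence of scalars with $\sup_N\|\sum_{n\le N}a_ne_n\|<\infty$. For a Banach space $Z$ with closed unit ball $B_Z$, a point $z\in Z$ with $\|z\|=1$ is a *Daugavet point* of $Z$ if $\sup_{y\in S}\|z-y\|=2$ for every slice $S=\{y\in B_Z: z^*(y)>1-\alpha\}$ with $z^*\in Z^*$, $\|z^*\|=1$, $\alpha>0$; it is a *super Daugavet point* of $Z$ if $\sup_{y\in V}\|z-y\|=2$ for every non-empty relatively weakly open subset $V$ of $B_Z$. A functional $f\in Z^*$ with $\|f\|=1$ is a *weak$^*$ super Daugavet point* of $Z^*$ if $\sup_{g\in V}\|f-g\|=2$ for every non-empty relatively weak$^*$ open subset $V$ of $B_{Z^*}$. Then there is an equivalent norm on $X$ for which $X$ has a Daugavet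 point. More precisely: 1. If $(e_n)$ is shrinking, or if $(e_n)$ is neither shrinking nor boundedly complete, then there is an equivalent norm $|||\cdot|||$ on $X$ such that $(X,|||\cdot|||)$ has a super Daugavet point and its dual $(X,|||\cdot|||)^*$ has a weak$^*$ super Daugavet point. 2. If $(e_n)$ is not shrinking, then there is an equivalent norm $|||\cdot|||$ on $X$ such that both $(X,|||\cdot|||)$ and its dual $(X,|||\cdot|||)^*$ have a Daugavet point. -/

import Mathlib

open Filter Topology

noncomputable section

/-! ### Equivalent norms -/

/-- An equivalent norm on a real normed space `X`. It is given as a seminorm that is bounded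
above and below by positive multiples of the original norm (hence it is a norm). -/
structure EquivalentNorm (X : Type*) [NormedAddCommGroup X] [NormedSpace ℝ X] extends
    Seminorm ℝ X where
  le_mul_norm : ∃ C : ℝ, 0 < C ∧ ∀ x : X, toSeminorm x ≤ C * ‖x‖
  mul_norm_le : ∃ c : ℝ, 0 < c ∧ ∀ x : X, c * ‖x‖ ≤ toSeminorm x

namespace EquivalentNorm

variable {X : Type*} [NormedAddCommGroup X] [NormedSpace ℝ X]

/-- The vector space `X` renormed by the equivalent norm `p`: a copy of `X` whose norm is `p`. -/
def Space (_p : EquivalentNorm X) : Type _ := X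

variable (p : EquivalentNorm X)

instance : AddCommGroup p.Space := inferInstanceAs (AddCommGroup X)

instance : Module ℝ p.Space := inferInstanceAs (Module ℝ X)

/-- The identity map from `X` to `X` renormed by `p`. -/
def toSpace : X ≃ₗ[ℝ] p.Space := LinearEquiv.refl ℝ X

instance : NormedAddCommGroup p.Space :=
  AddGroupNorm.toNormedAddCommGroup
    { toFun := fun x => p.toSeminorm (p.toSpace.symm x)
      map_zero' := by simp
      add_le' := fun x y => by simpa using map_add_le_add p.toSeminorm _ _
      neg' := fun x => by simp
      eq_zero_of_map_eq_zero' := fun x hx => by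
        obtain ⟨c, hc, h⟩ := p.mul_norm_le
        have h1 := h (p.toSpace.symm x)
        rw [hx] at h1
        have h2 : ‖p.toSpace.symm x‖ = 0 :=
          le_antisymm (nonpos_of_mul_nonpos_right h1 hc) (norm_nonneg _)
        simpa using h2 }

theorem norm_toSpace (x : X) : ‖p.toSpace x‖ = p.toSeminorm x := rfl

instance : NormedSpace ℝ p.Space where
  norm_smul_le a x := le_of_eq (map_smul_eq_mul p.toSeminorm a (p.toSpace.symm x))

end EquivalentNorm

/-! ### Daugavet points -/

section DaugavetPoints

variable {E : Type*} [NormedAddCommGroup E] [NormedSpace ℝ E]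

/-- The slice `{y ∈ B_E : f y > 1 - α}` of the closed unit ball of `E`
(to be used with `‖f‖ = 1` and `0 < α`). -/
def unitBallSlice (f : StrongDual ℝ E) (α : ℝ) : Set E :=
  {y | ‖y‖ ≤ 1 ∧ 1 - α < f y}

/-- The relatively weakly open subset of the closed unit ball of `E` cut out by the subset `U` of
`E` with its weak topology. -/
def unitBallWeak (U : Set (WeakSpace ℝ E)) : Set E :=
  {y | ‖y‖ ≤ 1 ∧ toWeakSpace ℝ E y ∈ U}

/-- The relatively weak* open subset of the closed unit ball of the dual of `E` cut out by the
subset `U` of the dual of `E` with its weak* topology. -/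
def dualUnitBallWeakStar (U : Set (WeakDual ℝ E)) : Set (StrongDual ℝ E) :=
  {g | ‖g‖ ≤ 1 ∧ StrongDual.toWeakDual g ∈ U}

/-- `x` is a Daugavet point: `‖x‖ = 1` and `sup_{y ∈ S} ‖x - y‖ = 2` for every slice `S` of the
closed unit ball. -/
def IsDaugavetPoint (x : E) : Prop :=
  ‖x‖ = 1 ∧ ∀ (f : StrongDual ℝ E) (α : ℝ), ‖f‖ = 1 → 0 < α →
    IsLUB ((fun y => ‖x - y‖) '' unitBallSlice f α) 2

/-- `x` is a super Daugavet point: `‖x‖ = 1` and `sup_{y ∈ V} ‖x - y‖ = 2` for every non-empty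
relatively weakly open subset `V` of the closed unit ball. -/
def IsSuperDaugavetPoint (x : E) : Prop :=
  ‖x‖ = 1 ∧ ∀ U : Set (WeakSpace ℝ E), IsOpen U → (unitBallWeak U).Nonempty →
    IsLUB ((fun y => ‖x - y‖) '' unitBallWeak U) 2

/-- `f` is a weak* super Daugavet point of the dual of `E`: `‖f‖ = 1` and
`sup_{g ∈ V} ‖f - g‖ = 2` for every non-empty relatively weak* open subset `V` of the closed unit
ball of the dual. -/
def IsWeakStarSuperDaugavetPoint (f : StrongDual ℝ E) : Prop :=
  ‖f‖ = 1 ∧ ∀ U : Set (WeakDual ℝ E), IsOpen U → (dualUnitBallWeakStar U).Nonempty →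
    IsLUB ((fun g => ‖f - g‖) '' dualUnitBallWeakStar U) 2

end DaugavetPoints

/-! ### Shrinking and boundedly complete bases -/

section Bases

variable {X : Type*} [NormedAddCommGroup X] [NormedSpace ℝ X]

/-- The basis is shrinking: the closed linear span of its biorthogonal functionals is the whole
dual space. -/
def IsShrinkingBasis (e : UnconditionalSchauderBasis ℕ ℝ X) : Prop :=
  (Submodule.span ℝ (Set.range e.coord)).topologicalClosure = ⊤

/-- The basis is boundedly complete: every series `∑ aₙ eₙ` with bounded partial sums
converges. -/
def IsBoundedlyCompleteBasis (e : UnconditionalSchauderBasis ℕ ℝ X) : Prop :=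
  ∀ a : ℕ → ℝ, BddAbove (Set.range fun N => ‖∑ n ∈ Finset.range N, a n • e.basis n‖) →
    ∃ x : X, Tendsto (fun N => ∑ n ∈ Finset.range N, a n • e.basis n) atTop (𝓝 x)

end Bases

end

/-!
The norms are built as follows. Let `D` be a bounded subset of a hyperplane `t = 1` of `X` such
that the closed absolutely convex hull of `D` is a neighbourhood of zero, and let `p` be the norm
with this hull as its unit ball (`IsPolarNorm`). A functional is in the dual unit ball exactly if
it is bounded by one on `D`. The candidate for a Daugavet point of the dual is `t`, and that of
the space is a point `x ∈ D`.

The Daugavet points come from `exists_norm_add_smul_le_one`. Suppose that a set `G` of functionals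
norms `E`, that every `g ∈ G` is `-1` at `x`, and that every `g ∈ G` is nonnegative at `z`.
Starting from a point `y` of the ball, move in the direction `z` as long as one stays in the ball.
The ball is left because some `g ∈ G` exceeds `1`, and where this happens one is almost antipodal
to `x`. If `z` runs through a seminormalized sequence that is null for the weak (weak*) topology,
then these points tend to `y` in it, so that `x` is a super (weak* super) Daugavet point. In the dual
one takes for `G` the evaluations at the points of `-D`: then `t` is a weak* super Daugavet point
as soon as there is a seminormalized weak* null sequence of functionals that are nonnegative on
`D`, and a super Daugavet point if the sequence is weakly null.

If the basis is shrinking or not boundedly complete, take `x = e 0`, `t = e.coord 0`, and for `D`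
the set of `x + v` with `v` in the positive part of the unit ball of a lattice norm on the closed
span of the other basis vectors. In terms of the positive functionals `φ` of norm at most one, the
unit ball is `{y | |2 φ y - t y| ≤ 1}`, as one sees by splitting `y` into its positive and
negative parts (`abs_apply_le_one_of_polar`). The functionals `2 φ - t` serve as `G`. Positive
weakly null sequences are given by the normalized basis in the shrinking case, and by blocks of
`∑ |aₙ| eₙ`, where `∑ aₙ eₙ` is a divergent series with bounded partial sums, if the basis is not
boundedly complete. In the dual one uses the normalized coordinate functionals.

If the basis is not shrinking, `X` contains a complemented copy of `ℓ₁`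
(`UnconditionalSchauderBasis.exists_isEllOneSystem`), and only this matters. Let `u 0`,
`a n = u (2 n + 1)` and `b n = u (2 n + 2)` be its basis vectors, and let `x = u 0` and `t` be the
coordinate of `u 0`. On the even part `b` the coordinates of the points of `D` are nonnegative,
and the coordinate functionals, being weakly null in the dual, make `t` a super Daugavet point of
the dual. On the odd part `a` it is the partial sums of the coordinates that are required to be in
`[0, 1]`. Adding a multiple of `a n - a (n + 1)` raises the `n`-th partial sum only, and once it
is `1` the resulting point is at distance `2` from `u 0`. These differences are not weakly null,
but their sums telescope, so their averages tend to zero. This suffices for slices, and `u 0` is a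
Daugavet point.
-/

/-! ### From nearby almost antipodal points to Daugavet points -/

section Criteria

variable {E : Type*} [NormedAddCommGroup E] [NormedSpace ℝ E]

theorem isLUB_norm_sub_image {E : Type*} [NormedAddCommGroup E] {x : E} (hx : ‖x‖ = 1)
    {V : Set E} (hV : ∀ y ∈ V, ‖y‖ ≤ 1)
    (h : ∀ ε : ℝ, 0 < ε → ∃ y ∈ V, 2 - ε ≤ ‖x - y‖) :
    IsLUB ((fun y => ‖x - y‖) '' V) 2 := by
  refine ⟨?_, fun b hb => le_of_forall_pos_le_add fun ε hε => ?_⟩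
  · rintro _ ⟨y, hy, rfl⟩
    have := norm_sub_le x y
    have := hV y hy
    dsimp only
    linarith
  · obtain ⟨y, hy, hxy⟩ := h ε hε
    have : ‖x - y‖ ≤ b := hb ⟨y, hy, rfl⟩
    linarith

theorem isSuperDaugavetPoint_of_forall_exists_seq {x : E} (hx : ‖x‖ = 1)
    (h : ∀ y : E, ‖y‖ ≤ 1 → ∀ ε : ℝ, 0 < ε → ∃ w : ℕ → E,
      (∀ k, ‖y + w k‖ ≤ 1 ∧ 2 - ε ≤ ‖x - (y + w k)‖) ∧
      ∀ f : StrongDual ℝ E, Tendsto (fun k => f (w k)) atTop (𝓝 0)) :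
    IsSuperDaugavetPoint x := by
  refine ⟨hx, fun U hU ⟨y, hy, hyU⟩ => isLUB_norm_sub_image hx (fun y hy => hy.1) ?_⟩
  intro ε hε
  obtain ⟨w, hw, hw0⟩ := h y hy ε hε
  have hlim : Tendsto (fun k => toWeakSpace ℝ E (y + w k)) atTop (𝓝 (toWeakSpace ℝ E y)) := by
    refine (WeakBilin.tendsto_iff_forall_eval_tendsto (topDualPairing ℝ E).flip
      (fun a b hab => ?_)).2 fun f => ?_
    · exact (SeparatingDual.eq_iff_forall_dual_eq (R := ℝ)).2 fun g => LinearMap.congr_fun hab g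
    · have := (hw0 f).const_add (f y)
      simp only [← map_add, add_zero] at this
      exact this
  obtain ⟨k, hk⟩ := (hlim.eventually (hU.mem_nhds hyU)).exists
  exact ⟨y + w k, ⟨(hw k).1, hk⟩, (hw k).2⟩

theorem isWeakStarSuperDaugavetPoint_of_forall_exists_seq {x : StrongDual ℝ E} (hx : ‖x‖ = 1)
    (h : ∀ y : StrongDual ℝ E, ‖y‖ ≤ 1 → ∀ ε : ℝ, 0 < ε → ∃ w : ℕ → StrongDual ℝ E,
      (∀ k, ‖y + w k‖ ≤ 1 ∧ 2 - ε ≤ ‖x - (y + w k)‖) ∧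
      ∀ a : E, Tendsto (fun k => w k a) atTop (𝓝 0)) :
    IsWeakStarSuperDaugavetPoint x := by
  refine ⟨hx, fun U hU ⟨y, hy, hyU⟩ => isLUB_norm_sub_image hx (fun y hy => hy.1) ?_⟩
  intro ε hε
  obtain ⟨w, hw, hw0⟩ := h y hy ε hε
  have hlim : Tendsto (fun k => StrongDual.toWeakDual (y + w k)) atTop
      (𝓝 (StrongDual.toWeakDual y)) := by
    refine tendsto_iff_forall_eval_tendsto_topDualPairing.2 fun a => ?_
    simpa only [add_zero] using! (hw0 a).const_add (y a)
  obtain ⟨k, hk⟩ := (hlim.eventually (hU.mem_nhds hyU)).exists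
  exact ⟨y + w k, ⟨(hw k).1, hk⟩, (hw k).2⟩

theorem IsSuperDaugavetPoint.isDaugavetPoint {x : E} (hx : IsSuperDaugavetPoint x) :
    IsDaugavetPoint x := by
  refine ⟨hx.1, fun f α hf hα => ?_⟩
  have hopen : IsOpen {y : WeakSpace ℝ E | 1 - α < f ((toWeakSpace ℝ E).symm y)} :=
    isOpen_lt continuous_const (WeakBilin.eval_continuous (topDualPairing ℝ E).flip f)
  refine hx.2 _ hopen ?_
  obtain ⟨y, hy, hfy⟩ := f.exists_lt_apply_of_lt_opNorm (r := 1 - α) (by linarith)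
  rcases le_total 0 (f y) with h0 | h0
  · exact ⟨y, hy.le, by simpa [abs_of_nonneg h0] using hfy⟩
  · refine ⟨-y, by simpa using hy.le, ?_⟩
    rw [Real.norm_eq_abs, abs_of_nonpos h0] at hfy
    simpa using hfy

/-- The points `y + s • z`, `s ≥ 0`, leave the unit ball through a norming functional `g` at which
`x` takes the value `-1`; the last one in the ball is then almost antipodal to `x`. -/
theorem exists_norm_add_smul_le_one {G : Set (StrongDual ℝ E)}
    (hG : ∀ y, ‖y‖ ≤ 1 ↔ ∀ g ∈ G, |g y| ≤ 1) {x z : E} (hx : ∀ g ∈ G, g x = -1)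
    (hz : ∀ g ∈ G, 0 ≤ g z) {δ : ℝ} (hδ : 0 < δ) (hδz : δ ≤ ‖z‖) {y : E} (hy : ‖y‖ ≤ 1)
    {ε : ℝ} (hε : 0 < ε) :
    ∃ s : ℝ, 0 ≤ s ∧ s ≤ 2 / δ ∧ ‖y + s • z‖ ≤ 1 ∧ 2 - ε ≤ ‖x - (y + s • z)‖ := by
  have hz0 : 0 < ‖z‖ := hδ.trans_le hδz
  have hGn : ∀ g ∈ G, ∀ w, |g w| ≤ ‖w‖ := by
    intro g hg w
    rcases eq_or_ne w 0 with rfl | hw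
    · simp
    have hw' : 0 < ‖w‖ := norm_pos_iff.2 hw
    have := (hG (‖w‖⁻¹ • w)).1 (by rw [norm_smul]; simp [hw'.ne']) g hg
    rw [map_smul, smul_eq_mul, abs_mul, abs_inv, abs_norm] at this
    rwa [inv_mul_le_iff₀ hw', mul_one] at this
  have hGy := (hG y).1 hy
  set S : Set ℝ := {s | 0 ≤ s ∧ ‖y + s • z‖ ≤ 1} with hS
  have hS0 : (0 : ℝ) ∈ S := ⟨le_rfl, by simpa using hy⟩
  have hSb : ∀ s ∈ S, s ≤ 2 / δ := by
    rintro s ⟨hs0, hs⟩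
    have h1 : ‖s • z‖ ≤ 2 := by
      have h2 := norm_sub_le (y + s • z) y
      rw [add_sub_cancel_left] at h2
      linarith
    rw [norm_smul, Real.norm_of_nonneg hs0] at h1
    rw [le_div_iff₀ hδ]
    exact (mul_le_mul_of_nonneg_left hδz hs0).trans h1
  have hbdd : BddAbove S := ⟨_, hSb⟩
  have hSc : IsClosed S := by
    have : IsClosed {s : ℝ | ‖y + s • z‖ ≤ 1} := isClosed_le (by fun_prop) continuous_const
    exact isClosed_Ici.inter this
  have hmem := hSc.csSup_mem ⟨0, hS0⟩ hbdd
  -- The largest admissible `s` works: beyond it some `g ∈ G` exceeds `1`, because no `g` can fall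
  -- below `-1`.
  refine ⟨sSup S, hmem.1, hSb _ hmem, hmem.2, ?_⟩
  set s := sSup S
  have hη : 0 < ε / ‖z‖ := by positivity
  have hnot : s + ε / ‖z‖ ∉ S := fun h => by
    have := le_csSup hbdd h
    linarith
  have hex : ∃ g ∈ G, 1 < g (y + (s + ε / ‖z‖) • z) := by
    by_contra! hcon
    refine hnot ⟨by linarith [hmem.1], (hG _).2 fun g hg => abs_le.2 ⟨?_, hcon g hg⟩⟩
    have h1 := (abs_le.1 (hGy g hg)).1
    have h2 := mul_nonneg (add_nonneg hmem.1 hη.le) (hz g hg)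
    rw [map_add, map_smul, smul_eq_mul]
    linarith
  obtain ⟨g, hg, hgt⟩ := hex
  have h1 : g (y + (s + ε / ‖z‖) • z) = g (y + s • z) + ε / ‖z‖ * g z := by
    simp only [map_add, map_smul, smul_eq_mul]; ring
  have h2 : ε / ‖z‖ * g z ≤ ε := by
    have := mul_le_mul_of_nonneg_left ((le_abs_self _).trans (hGn g hg z)) hη.le
    rwa [div_mul_cancel₀ _ hz0.ne'] at this
  have h3 := hGn g hg (x - (y + s • z))
  rw [map_sub, hx g hg] at h3
  have h4 := neg_le_abs (-1 - g (y + s • z))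
  linarith

theorem norm_eq_one_of_forall_apply_eq_neg_one {G : Set (StrongDual ℝ E)} (hne : G.Nonempty)
    (hG : ∀ y, ‖y‖ ≤ 1 ↔ ∀ g ∈ G, |g y| ≤ 1) {x : E} (hx : ∀ g ∈ G, g x = -1) : ‖x‖ = 1 := by
  have h1 : ‖x‖ ≤ 1 := (hG x).2 fun g hg => by simp [hx g hg]
  refine h1.antisymm (not_lt.1 fun hlt => ?_)
  obtain ⟨g, hg⟩ := hne
  rcases eq_or_ne x 0 with rfl | hx0
  · have := hx g hg
    simp at this
  have hpos : 0 < ‖x‖ := norm_pos_iff.2 hx0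
  have := (hG (‖x‖⁻¹ • x)).1 (by rw [norm_smul]; simp [hpos.ne']) g hg
  rw [map_smul, hx g hg, smul_eq_mul, abs_mul, abs_inv, abs_norm] at this
  rw [abs_neg, abs_one, mul_one] at this
  exact absurd ((one_lt_inv₀ hpos).2 hlt) (not_lt.2 this)

/-- Pushing any point of the ball along a sequence `z` on which all norming functionals are
nonnegative, one reaches points almost antipodal to `x`. -/
theorem exists_seq_of_norming {G : Set (StrongDual ℝ E)}
    (hG : ∀ y, ‖y‖ ≤ 1 ↔ ∀ g ∈ G, |g y| ≤ 1) {x : E} (hx : ∀ g ∈ G, g x = -1) {z : ℕ → E}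
    (hz : ∀ k, ∀ g ∈ G, 0 ≤ g (z k)) {δ : ℝ} (hδ : 0 < δ) (hδz : ∀ k, δ ≤ ‖z k‖) {y : E}
    (hy : ‖y‖ ≤ 1) {ε : ℝ} (hε : 0 < ε) :
    ∃ s : ℕ → ℝ, (∀ k, |s k| ≤ 2 / δ) ∧
      ∀ k, ‖y + s k • z k‖ ≤ 1 ∧ 2 - ε ≤ ‖x - (y + s k • z k)‖ := by
  choose s hs0 hs1 hs2 hs3 using fun k =>
    exists_norm_add_smul_le_one hG hx (hz k) hδ (hδz k) hy hε
  exact ⟨s, fun k => by rw [abs_of_nonneg (hs0 k)]; exact hs1 k, fun k => ⟨hs2 k, hs3 k⟩⟩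

theorem tendsto_mul_zero_of_abs_le {s r : ℕ → ℝ} {C : ℝ} (hs : ∀ k, |s k| ≤ C)
    (hr : Tendsto r atTop (𝓝 0)) : Tendsto (fun k => s k * r k) atTop (𝓝 0) := by
  refine squeeze_zero_norm (fun k => ?_) (by simpa using hr.abs.const_mul C)
  rw [norm_mul]
  exact mul_le_mul_of_nonneg_right (hs k) (norm_nonneg _)

/-- A criterion for super Daugavet points. Here `y ↦ sup {g y : g ∈ G}` is an asymmetric norm whose
symmetrization is the norm, and which the translation by `-x` raises by exactly one. -/
theorem isSuperDaugavetPoint_of_norming {G : Set (StrongDual ℝ E)} (hne : G.Nonempty)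
    (hG : ∀ y, ‖y‖ ≤ 1 ↔ ∀ g ∈ G, |g y| ≤ 1) {x : E} (hx : ∀ g ∈ G, g x = -1) {z : ℕ → E}
    (hz : ∀ k, ∀ g ∈ G, 0 ≤ g (z k)) {δ : ℝ} (hδ : 0 < δ) (hδz : ∀ k, δ ≤ ‖z k‖)
    (hw : ∀ f : StrongDual ℝ E, Tendsto (fun k => f (z k)) atTop (𝓝 0)) :
    IsSuperDaugavetPoint x := by
  refine isSuperDaugavetPoint_of_forall_exists_seq
    (norm_eq_one_of_forall_apply_eq_neg_one hne hG hx) fun y hy ε hε => ?_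
  obtain ⟨s, hs, h⟩ := exists_seq_of_norming hG hx hz hδ hδz hy hε
  exact ⟨fun k => s k • z k, h, fun f => by
    simpa using tendsto_mul_zero_of_abs_le hs (hw f)⟩

theorem isWeakStarSuperDaugavetPoint_of_norming {G : Set (StrongDual ℝ (StrongDual ℝ E))}
    (hne : G.Nonempty) (hG : ∀ y, ‖y‖ ≤ 1 ↔ ∀ g ∈ G, |g y| ≤ 1) {x : StrongDual ℝ E}
    (hx : ∀ g ∈ G, g x = -1) {z : ℕ → StrongDual ℝ E} (hz : ∀ k, ∀ g ∈ G, 0 ≤ g (z k))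
    {δ : ℝ} (hδ : 0 < δ) (hδz : ∀ k, δ ≤ ‖z k‖)
    (hw : ∀ a : E, Tendsto (fun k => z k a) atTop (𝓝 0)) :
    IsWeakStarSuperDaugavetPoint x := by
  refine isWeakStarSuperDaugavetPoint_of_forall_exists_seq
    (norm_eq_one_of_forall_apply_eq_neg_one hne hG hx) fun y hy ε hε => ?_
  obtain ⟨s, hs, h⟩ := exists_seq_of_norming hG hx hz hδ hδz hy hε
  exact ⟨fun k => s k • z k, h, fun a => by
    simpa using tendsto_mul_zero_of_abs_le hs (hw a)⟩

/-- A sequence of functionals `h` with `∑ |h n x| ≤ K ‖x‖` is weakly null in the dual: such a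
series is weakly unconditionally Cauchy. -/
theorem tendsto_apply_of_sum_abs_le {h : ℕ → StrongDual ℝ E} {K : ℝ} (hK : 0 ≤ K)
    (hh : ∀ (A : Finset ℕ) (x : E), ∑ n ∈ A, |h n x| ≤ K * ‖x‖)
    (F : StrongDual ℝ (StrongDual ℝ E)) : Tendsto (fun n => F (h n)) atTop (𝓝 0) := by
  have hs : Summable fun n => |F (h n)| := by
    refine summable_of_sum_le (c := ‖F‖ * K) (fun n => abs_nonneg _) fun A => ?_
    have h1 : ∑ n ∈ A, |F (h n)| = F (∑ n ∈ A, (SignType.sign (F (h n)) : ℝ) • h n) := by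
      rw [map_sum]
      exact Finset.sum_congr rfl fun n _ => by
        rw [map_smul, smul_eq_mul, sign_mul_self]
    rw [h1]
    refine (le_abs_self _).trans ((F.le_opNorm _).trans ?_)
    refine mul_le_mul_of_nonneg_left ?_ (norm_nonneg _)
    refine ContinuousLinearMap.opNorm_le_bound _ hK fun x => ?_
    refine le_trans ?_ (hh A x)
    rw [sum_apply]
    refine (Finset.abs_sum_le_sum_abs _ _).trans (Finset.sum_le_sum fun n _ => ?_)
    rw [smul_apply, smul_eq_mul, abs_mul]
    refine mul_le_of_le_one_left (abs_nonneg _) ?_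
    rcases lt_trichotomy (F (h n)) 0 with h | h | h <;> simp [h]
  exact tendsto_zero_iff_abs_tendsto_zero _ |>.2 hs.tendsto_atTop_zero

end Criteria

/-! ### Equivalent norms given by a polar set -/

section PolarNorm

variable {X : Type*} [NormedAddCommGroup X] [NormedSpace ℝ X]

/-- `p` is the norm whose dual unit ball is the (absolute) polar of `D`, that is
`p x = sup {|f x| : |f| ≤ 1 on D}`: its unit ball is the closed absolutely convex hull of `D`. The
supremum is expressed by its two defining properties. -/
structure IsPolarNorm (p : EquivalentNorm X) (D : Set X) : Prop where
  abs_le : ∀ f : StrongDual ℝ X, (∀ d ∈ D, |f d| ≤ 1) → ∀ x, |f x| ≤ p.toSeminorm x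
  le_of_forall : ∀ x M, (∀ f : StrongDual ℝ X, (∀ d ∈ D, |f d| ≤ 1) → |f x| ≤ M) →
    p.toSeminorm x ≤ M

/-- A bounded set whose polar is bounded is the polar set of an equivalent norm. -/
theorem exists_isPolarNorm {D : Set X} {R C : ℝ} (hR : ∀ d ∈ D, ‖d‖ ≤ R)
    (hC : ∀ f : StrongDual ℝ X, (∀ d ∈ D, |f d| ≤ 1) → ‖f‖ ≤ C) :
    ∃ p : EquivalentNorm X, IsPolarNorm p D := by
  let P := {f : StrongDual ℝ X // ∀ d ∈ D, |f d| ≤ 1}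
  have : Nonempty P := ⟨⟨0, by simp⟩⟩
  have hC0 : 0 ≤ C := by simpa using hC 0 (by simp)
  have hb : ∀ x : X, ∀ f : P, |f.1 x| ≤ C * ‖x‖ := fun x f =>
    (f.1.le_opNorm x).trans (mul_le_mul_of_nonneg_right (hC f.1 f.2) (norm_nonneg _))
  have hbdd : ∀ x : X, BddAbove (Set.range fun f : P => |f.1 x|) := fun x =>
    ⟨C * ‖x‖, by rintro _ ⟨f, rfl⟩; exact hb x f⟩
  have hsmul : ∀ (a : ℝ) (x : X), ⨆ f : P, |f.1 (a • x)| = ‖a‖ * ⨆ f : P, |f.1 x| := by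
    intro a x
    rw [Real.mul_iSup_of_nonneg (norm_nonneg a)]
    simp [abs_mul]
  have hadd : ∀ x y : X, ⨆ f : P, |f.1 (x + y)| ≤ (⨆ f : P, |f.1 x|) + ⨆ f : P, |f.1 y| := by
    intro x y
    refine ciSup_le fun f => ?_
    rw [map_add]
    exact (abs_add_le _ _).trans (add_le_add (le_ciSup (hbdd x) f) (le_ciSup (hbdd y) f))
  let q : Seminorm ℝ X := Seminorm.of (fun x => ⨆ f : P, |f.1 x|) hadd hsmul
  have hq : ∀ x, q x = ⨆ f : P, |f.1 x| := fun x => rfl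
  set R' := max R 1
  have hR' : 0 < R' := lt_max_of_lt_right one_pos
  refine ⟨⟨q, ⟨C + 1, by linarith, fun x => ?_⟩, ⟨R'⁻¹, by positivity, fun x => ?_⟩⟩,
    fun f hf x => ?_, fun x M h => ?_⟩
  · rw [hq]
    refine (ciSup_le (hb x)).trans ?_
    nlinarith [norm_nonneg x]
  · obtain ⟨f, hf1, hfx⟩ := exists_dual_vector'' ℝ x
    have hmem : ∀ d ∈ D, |(R'⁻¹ • f) d| ≤ 1 := by
      intro d hd
      rw [smul_apply, smul_eq_mul, abs_mul, abs_of_pos (inv_pos.2 hR'),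
        inv_mul_le_iff₀ hR', mul_one]
      refine (f.le_opNorm d).trans ?_
      have h1 : ‖d‖ ≤ R' := (hR d hd).trans (le_max_left _ _)
      nlinarith [norm_nonneg d, norm_nonneg f]
    have := le_ciSup (hbdd x) ⟨R'⁻¹ • f, hmem⟩
    rw [hq]
    refine le_trans (le_of_eq ?_) this
    simp only [smul_apply, hfx, smul_eq_mul, abs_mul, RCLike.ofReal_real_eq_id, id, abs_norm]
    rw [abs_of_pos (inv_pos.2 hR')]
  · exact le_ciSup (hbdd x) ⟨f, hf⟩
  · exact ciSup_le fun f => h f.1 f.2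

namespace EquivalentNorm

variable (p : EquivalentNorm X)

/-- The identity map from `X` to `X` renormed by `p`, as an isomorphism of Banach spaces. -/
noncomputable def toSpaceL : X ≃L[ℝ] p.Space :=
  p.toSpace.toContinuousLinearEquivOfBounds p.le_mul_norm.choose p.mul_norm_le.choose⁻¹
    p.le_mul_norm.choose_spec.2 fun x => by
      rw [le_inv_mul_iff₀ p.mul_norm_le.choose_spec.1]
      exact p.mul_norm_le.choose_spec.2 (p.toSpace.symm x)

theorem norm_toSpaceL (x : X) : ‖p.toSpaceL x‖ = p.toSeminorm x := rfl

/-- A continuous functional on `X`, as a continuous functional on `X` renormed by `p`. -/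
noncomputable def functional (f : StrongDual ℝ X) : StrongDual ℝ p.Space :=
  f.comp (p.toSpaceL.symm : p.Space →L[ℝ] X)

@[simp]
theorem functional_toSpaceL (f : StrongDual ℝ X) (x : X) : p.functional f (p.toSpaceL x) = f x := by
  simp [functional]

theorem exists_le_norm_functional :
    ∃ c : ℝ, 0 < c ∧ ∀ f : StrongDual ℝ X, c * ‖f‖ ≤ ‖p.functional f‖ := by
  obtain ⟨C, hC, h⟩ := p.le_mul_norm
  refine ⟨C⁻¹, inv_pos.2 hC, fun f => ?_⟩
  rw [inv_mul_le_iff₀ hC]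
  refine f.opNorm_le_bound (by positivity) fun x => ?_
  rw [← p.functional_toSpaceL]
  refine ((p.functional f).le_opNorm _).trans ?_
  rw [norm_toSpaceL]
  nlinarith [h x, norm_nonneg (p.functional f)]

end EquivalentNorm

namespace IsPolarNorm

variable {p : EquivalentNorm X} {D : Set X} (hp : IsPolarNorm p D)
include hp

theorem norm_toSpaceL_le_one {d : X} (hd : d ∈ D) : ‖p.toSpaceL d‖ ≤ 1 :=
  hp.le_of_forall d 1 fun _ hf => hf d hd

theorem norm_dual_le_one_iff (F : StrongDual ℝ p.Space) :
    ‖F‖ ≤ 1 ↔ ∀ d ∈ D, |F (p.toSpaceL d)| ≤ 1 := by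
  refine ⟨fun hF d hd => ?_, fun h => F.opNorm_le_bound zero_le_one fun y => ?_⟩
  · refine (F.le_opNorm _).trans ?_
    exact mul_le_one₀ hF (norm_nonneg _) (hp.norm_toSpaceL_le_one hd)
  · obtain ⟨x, rfl⟩ := p.toSpaceL.surjective y
    rw [one_mul]
    exact hp.abs_le (F.comp (p.toSpaceL : X →L[ℝ] p.Space)) h x

/-- Let `D` lie in the hyperplane `t = 1`. Then the evaluations at the points of `-D` norm the dual,
take the value `-1` at `t`, and are nonnegative at `-h k` if `h k` is nonnegative on `D`. -/
theorem dual_norming (t : StrongDual ℝ X) (hne : D.Nonempty) (ht : ∀ d ∈ D, t d = 1)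
    {h : ℕ → StrongDual ℝ X} (hh : ∀ k, ∀ d ∈ D, 0 ≤ h k d) :
    ∃ G : Set (StrongDual ℝ (StrongDual ℝ p.Space)), G.Nonempty ∧
      (∀ F, ‖F‖ ≤ 1 ↔ ∀ g ∈ G, |g F| ≤ 1) ∧ (∀ g ∈ G, g (p.functional t) = -1) ∧
      ∀ k, ∀ g ∈ G, 0 ≤ g (-p.functional (h k)) := by
  refine ⟨(fun d => NormedSpace.inclusionInDoubleDual ℝ p.Space (-p.toSpaceL d)) '' D,
    hne.image _, fun F => ?_, ?_, ?_⟩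
  · rw [hp.norm_dual_le_one_iff]
    simp
  · rintro _ ⟨d, hd, rfl⟩
    simp [ht d hd]
  · rintro k _ ⟨d, hd, rfl⟩
    simpa using hh k d hd

theorem isWeakStarSuperDaugavetPoint (t : StrongDual ℝ X) (hne : D.Nonempty)
    (ht : ∀ d ∈ D, t d = 1) {h : ℕ → StrongDual ℝ X} (hh : ∀ k, ∀ d ∈ D, 0 ≤ h k d) {δ : ℝ}
    (hδ : 0 < δ) (hδh : ∀ k, δ ≤ ‖h k‖) (hw : ∀ x, Tendsto (fun k => h k x) atTop (𝓝 0)) :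
    IsWeakStarSuperDaugavetPoint (p.functional t) := by
  obtain ⟨G, hne, hG, hx, hz⟩ := hp.dual_norming t hne ht hh
  obtain ⟨c, hc, hcn⟩ := p.exists_le_norm_functional
  refine isWeakStarSuperDaugavetPoint_of_norming hne hG hx hz (mul_pos hc hδ) (fun k => ?_)
    fun y => ?_
  · rw [norm_neg]
    exact (mul_le_mul_of_nonneg_left (hδh k) hc.le).trans (hcn _)
  · obtain ⟨x, rfl⟩ := p.toSpaceL.surjective y
    simpa using (hw x).neg

theorem isSuperDaugavetPoint_dual (t : StrongDual ℝ X) (hne : D.Nonempty)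
    (ht : ∀ d ∈ D, t d = 1) {h : ℕ → StrongDual ℝ X} (hh : ∀ k, ∀ d ∈ D, 0 ≤ h k d) {δ : ℝ}
    (hδ : 0 < δ) (hδh : ∀ k, δ ≤ ‖h k‖) {K : ℝ} (hK : 0 ≤ K)
    (hw : ∀ (A : Finset ℕ) (x : X), ∑ n ∈ A, |h n x| ≤ K * ‖x‖) :
    IsSuperDaugavetPoint (p.functional t) := by
  obtain ⟨G, hne, hG, hx, hz⟩ := hp.dual_norming t hne ht hh
  obtain ⟨c, hc, hcn⟩ := p.exists_le_norm_functional
  obtain ⟨b, hb, hbn⟩ := p.mul_norm_le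
  refine isSuperDaugavetPoint_of_norming hne hG hx hz (mul_pos hc hδ) (fun k => ?_)
    (tendsto_apply_of_sum_abs_le (K := K * b⁻¹) (by positivity) fun A y => ?_)
  · rw [norm_neg]
    exact (mul_le_mul_of_nonneg_left (hδh k) hc.le).trans (hcn _)
  · obtain ⟨x, rfl⟩ := p.toSpaceL.surjective y
    simp only [neg_apply, EquivalentNorm.functional_toSpaceL, abs_neg]
    refine (hw A x).trans ?_
    rw [mul_assoc]
    refine mul_le_mul_of_nonneg_left ?_ hK
    rw [le_inv_mul_iff₀ hb]
    exact hbn x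

end IsPolarNorm

end PolarNorm

/-! ### Unconditional bases -/

section UnconditionalBasis

variable {X : Type*} [NormedAddCommGroup X] [NormedSpace ℝ X]
  (e : UnconditionalSchauderBasis ℕ ℝ X)

namespace UnconditionalSchauderBasis

theorem coord_basis_self (n : ℕ) : e.coord n (e n) = 1 := by simp [e.ortho]

theorem coord_basis_of_ne {m n : ℕ} (h : m ≠ n) : e.coord m (e n) = 0 := by
  simp [e.ortho, h]

theorem coord_basis (m n : ℕ) : e.coord m (e n) = if m = n then 1 else 0 := by
  split_ifs with h
  · rw [h, e.coord_basis_self]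
  · exact e.coord_basis_of_ne h

theorem proj_proj (A B : Finset ℕ) (x : X) : e.proj A (e.proj B x) = e.proj (A ∩ B) x := by
  rw [e.proj_comp]
  congr!

theorem basis_ne_zero (n : ℕ) : e n ≠ 0 := fun h => by
  have := e.coord_basis_self n
  simp [h] at this

theorem coord_ne_zero (n : ℕ) : e.coord n ≠ 0 := fun h => by
  have := e.coord_basis_self n
  simp [h] at this

theorem apply_proj (f : StrongDual ℝ X) (A : Finset ℕ) (x : X) :
    f (e.proj A x) = ∑ n ∈ A, e.coord n x * f (e n) := by
  simp

theorem tendsto_apply_proj (f : StrongDual ℝ X) (x : X) :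
    Tendsto (fun A => f (e.proj A x)) atTop (𝓝 (f x)) := by
  have h := e.tendsto_proj x
  rw [SummationFilter.unconditional_filter] at h
  exact (f.continuous.tendsto x).comp h

theorem coord_proj (n : ℕ) (A : Finset ℕ) (x : X) :
    e.coord n (e.proj A x) = if n ∈ A then e.coord n x else 0 := by
  rw [e.apply_proj]
  simp [e.coord_basis]

theorem exists_one_le_norm_proj_le [CompleteSpace X] :
    ∃ K : ℝ, 1 ≤ K ∧ ∀ A : Finset ℕ, ‖e.proj A‖ ≤ K := by
  obtain ⟨K, hK⟩ := e.exists_norm_proj_le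
  exact ⟨max K 1, le_max_right _ _, fun A => (hK A).trans (le_max_left _ _)⟩

theorem abs_apply_proj_le {K : ℝ} (hK : ∀ A : Finset ℕ, ‖e.proj A‖ ≤ K) (f : StrongDual ℝ X)
    (A : Finset ℕ) (x : X) : |f (e.proj A x)| ≤ K * (‖f‖ * ‖x‖) := by
  refine (f.le_opNorm _).trans ?_
  have h1 := (e.proj A).le_of_opNorm_le (hK A) x
  nlinarith [norm_nonneg f]

theorem sum_abs_coord_mul_le {K : ℝ} (hK : ∀ A : Finset ℕ, ‖e.proj A‖ ≤ K)
    (f : StrongDual ℝ X) (A : Finset ℕ) (x : X) :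
    ∑ n ∈ A, |e.coord n x * f (e n)| ≤ 2 * K * (‖f‖ * ‖x‖) := by
  rw [← Finset.sum_filter_add_sum_filter_not A fun n => 0 ≤ e.coord n x * f (e n)]
  have h1 : ∑ n ∈ A with 0 ≤ e.coord n x * f (e n), |e.coord n x * f (e n)| ≤
      K * (‖f‖ * ‖x‖) := by
    refine le_trans ?_ (e.abs_apply_proj_le hK f {n ∈ A | 0 ≤ e.coord n x * f (e n)} x)
    rw [e.apply_proj]
    refine le_trans (Finset.sum_le_sum fun n hn => ?_) (le_abs_self _)
    rw [abs_of_nonneg (Finset.mem_filter.1 hn).2]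
  have h2 : ∑ n ∈ A with ¬ 0 ≤ e.coord n x * f (e n), |e.coord n x * f (e n)| ≤
      K * (‖f‖ * ‖x‖) := by
    refine le_trans ?_ (e.abs_apply_proj_le hK f {n ∈ A | ¬ 0 ≤ e.coord n x * f (e n)} x)
    rw [e.apply_proj]
    refine le_trans ?_ (neg_le_abs _)
    rw [← Finset.sum_neg_distrib]
    refine Finset.sum_le_sum fun n hn => ?_
    rw [abs_of_nonpos (not_le.1 (Finset.mem_filter.1 hn).2).le]
  linarith

theorem apply_nonneg {φ : StrongDual ℝ X} (hφ : ∀ n, 0 ≤ φ (e n)) {x : X}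
    (hx : ∀ n, 0 ≤ e.coord n x) : 0 ≤ φ x := by
  refine ge_of_tendsto' (e.tendsto_apply_proj φ x) fun A => ?_
  rw [e.apply_proj]
  exact Finset.sum_nonneg fun n _ => mul_nonneg (hx n) (hφ n)

/-! ### The order renorming -/

/-- The positive functionals that vanish at `e 0` and have all their restrictions to finite sets of
coordinates in the dual unit ball. They form the positive part of the dual unit ball of a lattice
norm on the closed span of `e 1, e 2, …`. -/
def positiveDualBall : Set (StrongDual ℝ X) :=
  {φ | φ (e 0) = 0 ∧ (∀ n, 0 ≤ φ (e n)) ∧ ∀ A : Finset ℕ, ‖φ.comp (e.proj A)‖ ≤ 1}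

/-- The vectors `e 0 + v`, where `v` is in the positive part of the unit ball of a lattice norm on
the closed span of `e 1, e 2, …`. -/
def positiveCap : Set X :=
  {d | e.coord 0 d = 1 ∧ (∀ n, 0 ≤ e.coord n d) ∧ ∀ φ ∈ e.positiveDualBall, φ d ≤ 1}

theorem zero_mem_positiveDualBall : (0 : StrongDual ℝ X) ∈ e.positiveDualBall := by
  refine ⟨by simp, by simp, fun A => ?_⟩
  rw [ContinuousLinearMap.zero_comp, norm_zero]
  exact zero_le_one

theorem basis_zero_mem_positiveCap : e 0 ∈ e.positiveCap := by
  refine ⟨e.coord_basis_self 0, fun n => ?_, fun φ hφ => ?_⟩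
  · rw [e.coord_basis]
    split_ifs <;> norm_num
  · rw [hφ.1]
    exact zero_le_one

variable {e}

theorem abs_apply_le_of_mem_positiveDualBall {φ : StrongDual ℝ X} (hφ : φ ∈ e.positiveDualBall)
    (x : X) : |φ x| ≤ ‖x‖ :=
  le_of_tendsto' (e.tendsto_apply_proj φ x).abs fun A => by
    simpa using! (φ.comp (e.proj A)).le_of_opNorm_le (hφ.2.2 A) x

theorem comp_proj_mem_positiveDualBall {φ : StrongDual ℝ X} (hφ : φ ∈ e.positiveDualBall)
    (A : Finset ℕ) : φ.comp (e.proj A) ∈ e.positiveDualBall := by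
  refine ⟨?_, fun n => ?_, fun B => ?_⟩
  · rw [ContinuousLinearMap.comp_apply, e.proj_apply_basis_mem]
    split_ifs <;> simp [hφ.1]
  · rw [ContinuousLinearMap.comp_apply, e.proj_apply_basis_mem]
    split_ifs
    · exact hφ.2.1 n
    · simp
  · have : (φ.comp (e.proj A)).comp (e.proj B) = φ.comp (e.proj (A ∩ B)) := by
      ext x
      simp only [ContinuousLinearMap.comp_apply, e.proj_proj]
    rw [this]
    exact hφ.2.2 _

theorem norm_le_of_mem_positiveCap {K : ℝ} (hK1 : 1 ≤ K) (hK : ∀ A : Finset ℕ, ‖e.proj A‖ ≤ K)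
    {d : X} (hd : d ∈ e.positiveCap) : ‖d‖ ≤ K + ‖e 0‖ := by
  obtain ⟨f, hf1, hfd⟩ := exists_dual_vector'' ℝ d
  simp only [RCLike.ofReal_real_eq_id, id] at hfd
  rw [← hfd]
  refine le_of_tendsto' (e.tendsto_apply_proj f d) fun A => ?_
  set B : Finset ℕ := {n ∈ A | n ≠ 0 ∧ 0 ≤ f (e n)} with hB
  have hK0 : 0 < K := by linarith
  have hφ : K⁻¹ • f.comp (e.proj B) ∈ e.positiveDualBall := by
    refine ⟨?_, fun n => ?_, fun C => ?_⟩
    · rw [smul_apply, ContinuousLinearMap.comp_apply, e.proj_apply_basis_mem, if_neg (by simp [hB])]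
      simp
    · rw [smul_apply, ContinuousLinearMap.comp_apply, e.proj_apply_basis_mem]
      refine mul_nonneg (by positivity) ?_
      split_ifs with h
      · exact (Finset.mem_filter.1 h).2.2
      · simp
    · have : (K⁻¹ • f.comp (e.proj B)).comp (e.proj C) = K⁻¹ • f.comp (e.proj (B ∩ C)) := by
        ext x
        simp only [ContinuousLinearMap.comp_apply, smul_apply, e.proj_proj]
      rw [this, norm_smul, Real.norm_of_nonneg (by positivity), inv_mul_le_iff₀ hK0, mul_one]
      refine (ContinuousLinearMap.opNorm_comp_le _ _).trans ?_
      exact (mul_le_of_le_one_left (norm_nonneg _) hf1).trans (hK _)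
  have h1 := hd.2.2 _ hφ
  rw [smul_apply, smul_eq_mul, inv_mul_le_iff₀ hK0, mul_one, ContinuousLinearMap.comp_apply,
    e.apply_proj] at h1
  have h2 : |f (e 0)| ≤ ‖e 0‖ := by
    simpa using f.le_of_opNorm_le hf1 (e 0)
  rw [e.apply_proj, ← Finset.sum_filter_add_sum_filter_not A fun n => n ≠ 0 ∧ 0 ≤ f (e n)]
  refine add_le_add h1 ?_
  calc ∑ n ∈ A with ¬ (n ≠ 0 ∧ 0 ≤ f (e n)), e.coord n d * f (e n)
      ≤ ∑ n ∈ A with ¬ (n ≠ 0 ∧ 0 ≤ f (e n)), if n = 0 then ‖e 0‖ else 0 := by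
        refine Finset.sum_le_sum fun n hn => ?_
        split_ifs with h0
        · rw [h0, hd.1, one_mul]
          exact (le_abs_self _).trans h2
        · have := (Finset.mem_filter.1 hn).2
          push Not at this
          exact mul_nonpos_of_nonneg_of_nonpos (hd.2.1 n) (this h0).le
    _ ≤ ‖e 0‖ := by
        rw [Finset.sum_ite_eq']
        split_ifs <;> simp

/-- Homogeneous form of the condition that `f` is bounded by one on `positiveCap`. -/
theorem abs_mul_add_le_of_polar {f : StrongDual ℝ X} (hf : ∀ d ∈ e.positiveCap, |f d| ≤ 1) {v : X}
    (hv0 : e.coord 0 v = 0) (hv : ∀ n, 0 ≤ e.coord n v) {r : ℝ} (hr : 0 ≤ r)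
    (hvr : ∀ φ ∈ e.positiveDualBall, φ v ≤ r) : |r * f (e 0) + f v| ≤ r := by
  refine le_of_forall_pos_le_add fun ε hε => ?_
  set r' := r + ε / 2 with hr'
  have hr0 : 0 < r' := by positivity
  have hmem : e 0 + r'⁻¹ • v ∈ e.positiveCap := by
    refine ⟨by simp [e.coord_basis_self, hv0], fun n => ?_, fun φ hφ => ?_⟩
    · rw [map_add, map_smul]
      exact add_nonneg (e.basis_zero_mem_positiveCap.2.1 n)
        (mul_nonneg (inv_pos.2 hr0).le (hv n))
    · rw [map_add, hφ.1, zero_add, map_smul, smul_eq_mul, inv_mul_le_iff₀ hr0, mul_one]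
      linarith [hvr φ hφ]
  have h0 := abs_le.1 (hf _ e.basis_zero_mem_positiveCap)
  have h1 := hf _ hmem
  rw [map_add, map_smul, smul_eq_mul] at h1
  have h2 : |r' * f (e 0) + f v| ≤ r' := by
    have : r' * f (e 0) + f v = r' * (f (e 0) + r'⁻¹ * f v) := by field_simp
    rw [this, abs_mul, abs_of_pos hr0]
    exact mul_le_of_le_one_right hr0.le h1
  rw [abs_le] at h2 ⊢
  constructor <;> nlinarith [h0.1, h0.2, h2.1, h2.2]

theorem apply_le_one_of_polar {f : StrongDual ℝ X} (hf : ∀ d ∈ e.positiveCap, |f d| ≤ 1) {x : X}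
    (hx : ∀ φ ∈ e.positiveDualBall, |2 * φ x - e.coord 0 x| ≤ 1) : f x ≤ 1 := by
  have ht : |e.coord 0 x| ≤ 1 := by simpa using hx 0 e.zero_mem_positiveDualBall
  rw [abs_le] at ht
  refine le_of_tendsto (e.tendsto_apply_proj f x) ?_
  filter_upwards [eventually_ge_atTop ({0} : Finset ℕ)] with A hA
  have h0A : 0 ∈ A := by simpa using hA
  set B : Finset ℕ := {n ∈ A.erase 0 | 0 ≤ e.coord n x} with hB
  set C : Finset ℕ := {n ∈ A.erase 0 | ¬ 0 ≤ e.coord n x} with hC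
  have h1 : |(1 + e.coord 0 x) / 2 * f (e 0) + f (e.proj B x)| ≤ (1 + e.coord 0 x) / 2 := by
    refine abs_mul_add_le_of_polar hf ?_ (fun n => ?_) (by linarith) fun φ hφ => ?_
    · rw [e.coord_proj, if_neg (by simp [hB])]
    · rw [e.coord_proj]
      split_ifs with h
      · exact (Finset.mem_filter.1 h).2
      · exact le_rfl
    · have := (abs_le.1 (hx _ (comp_proj_mem_positiveDualBall hφ B))).2
      rw [ContinuousLinearMap.comp_apply] at this
      linarith
  have h2 : |(1 - e.coord 0 x) / 2 * f (e 0) + f (-e.proj C x)| ≤ (1 - e.coord 0 x) / 2 := by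
    refine abs_mul_add_le_of_polar hf ?_ (fun n => ?_) (by linarith) fun φ hφ => ?_
    · rw [map_neg, e.coord_proj, if_neg (by simp [hC]), neg_zero]
    · rw [map_neg, e.coord_proj]
      split_ifs with h
      · exact neg_nonneg.2 (not_le.1 (Finset.mem_filter.1 h).2).le
      · simp
    · have := (abs_le.1 (hx _ (comp_proj_mem_positiveDualBall hφ C))).1
      rw [ContinuousLinearMap.comp_apply] at this
      rw [map_neg]
      linarith
  have h3 : f (e.proj A x) = e.coord 0 x * f (e 0) + (f (e.proj B x) + f (e.proj C x)) := by
    rw [e.apply_proj, e.apply_proj, e.apply_proj, Finset.sum_filter_add_sum_filter_not,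
      Finset.add_sum_erase A (fun n => e.coord n x * f (e n)) h0A]
  rw [map_neg] at h2
  have h1' := (abs_le.1 h1).2
  have h2' := (abs_le.1 h2).1
  rw [h3]
  linarith

theorem abs_apply_le_one_of_polar {f : StrongDual ℝ X} (hf : ∀ d ∈ e.positiveCap, |f d| ≤ 1)
    {x : X} (hx : ∀ φ ∈ e.positiveDualBall, |2 * φ x - e.coord 0 x| ≤ 1) : |f x| ≤ 1 := by
  refine abs_le.2 ⟨?_, apply_le_one_of_polar hf hx⟩
  have := apply_le_one_of_polar (f := -f) (by simpa using hf) hx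
  rw [neg_apply] at this
  linarith

theorem two_smul_sub_coord_mem_polar {φ : StrongDual ℝ X} (hφ : φ ∈ e.positiveDualBall) {d : X}
    (hd : d ∈ e.positiveCap) : |((2 : ℝ) • φ - e.coord 0) d| ≤ 1 := by
  have h1 := hd.2.2 φ hφ
  have h2 := e.apply_nonneg hφ.2.1 hd.2.1
  rw [sub_apply, smul_apply, smul_eq_mul, hd.1, abs_le]
  constructor <;> linarith

theorem norm_le_of_polar {f : StrongDual ℝ X} (hf : ∀ d ∈ e.positiveCap, |f d| ≤ 1) :
    ‖f‖ ≤ 2 + ‖e.coord 0‖ := by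
  have hr : 0 < 2 + ‖e.coord 0‖ := by positivity
  refine ContinuousLinearMap.opNorm_le_of_unit_norm hr.le fun x hx => ?_
  have : |f ((2 + ‖e.coord 0‖)⁻¹ • x)| ≤ 1 := by
    refine abs_apply_le_one_of_polar hf fun φ hφ => ?_
    have h1 := abs_apply_le_of_mem_positiveDualBall hφ x
    have h2 := (e.coord 0).le_opNorm x
    rw [hx] at h1 h2
    rw [mul_one, Real.norm_eq_abs] at h2
    rw [map_smul, map_smul, smul_eq_mul, smul_eq_mul,
      show 2 * ((2 + ‖e.coord 0‖)⁻¹ * φ x) - (2 + ‖e.coord 0‖)⁻¹ * e.coord 0 x =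
        (2 + ‖e.coord 0‖)⁻¹ * (2 * φ x - e.coord 0 x) by ring, abs_mul,
      abs_of_pos (inv_pos.2 hr), inv_mul_le_iff₀ hr, mul_one]
    rw [abs_le] at h1 h2 ⊢
    constructor <;> linarith
  rw [map_smul, smul_eq_mul, abs_mul, abs_of_pos (inv_pos.2 hr), inv_mul_le_iff₀ hr,
    mul_one] at this
  exact this

variable (e)

theorem tendsto_inv_norm_smul_coord (x : X) :
    Tendsto (fun n => (‖e.coord (n + 1)‖⁻¹ • e.coord (n + 1)) x) atTop (𝓝 0) := by
  have h := ((e.expansion x).summable.tendsto_atTop_zero.norm.comp (tendsto_add_atTop_nat 1))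
  rw [norm_zero] at h
  refine squeeze_zero_norm (fun n => ?_) h
  rw [smul_apply, norm_smul, norm_inv, norm_norm, Function.comp_apply, norm_smul,
    inv_mul_le_iff₀ (norm_pos_iff.2 (e.coord_ne_zero _))]
  have h1 := (e.coord (n + 1)).le_opNorm (e (n + 1))
  rw [e.coord_basis_self, norm_one] at h1
  nlinarith [norm_nonneg (e.coord (n + 1) x)]

/-- The renorming with unit ball the closed absolutely convex hull of `positiveCap`: positive
weakly null sequences make `e 0` a super Daugavet point, and normalized coordinate functionals make
`e.coord 0` a weak* super Daugavet point. -/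
theorem exists_superDaugavet_of_positive_weaklyNull [CompleteSpace X] {z : ℕ → X}
    (hz0 : ∀ k, e.coord 0 (z k) = 0) (hz : ∀ k n, 0 ≤ e.coord n (z k)) {δ : ℝ} (hδ : 0 < δ)
    (hδz : ∀ k, δ ≤ ‖z k‖)
    (hw : ∀ f : StrongDual ℝ X, Tendsto (fun k => f (z k)) atTop (𝓝 0)) :
    ∃ p : EquivalentNorm X, (∃ x : p.Space, IsSuperDaugavetPoint x) ∧
      ∃ f : StrongDual ℝ p.Space, IsWeakStarSuperDaugavetPoint f := by
  obtain ⟨K, hK1, hK⟩ := e.exists_one_le_norm_proj_le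
  obtain ⟨p, hp⟩ := exists_isPolarNorm (D := e.positiveCap)
    (fun d hd => norm_le_of_mem_positiveCap hK1 hK hd) (fun f hf => norm_le_of_polar hf)
  refine ⟨p, ⟨p.toSpaceL (e 0), ?_⟩, ⟨p.functional (e.coord 0), ?_⟩⟩
  · obtain ⟨c, hc, hcn⟩ := p.mul_norm_le
    refine isSuperDaugavetPoint_of_norming (z := fun k => p.toSpaceL (z k))
      (G := (fun φ => p.functional ((2 : ℝ) • φ - e.coord 0)) '' e.positiveDualBall)
      (Set.Nonempty.image _ ⟨0, e.zero_mem_positiveDualBall⟩) (fun y => ?_) ?_ ?_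
      (mul_pos hc hδ) (fun k => ?_) fun f => ?_
    · obtain ⟨x, rfl⟩ := p.toSpaceL.surjective y
      rw [Set.forall_mem_image]
      refine ⟨fun h φ hφ => ?_, fun h => hp.le_of_forall x 1 fun f hf => ?_⟩
      · rw [p.functional_toSpaceL]
        exact (hp.abs_le _ (fun d hd => two_smul_sub_coord_mem_polar hφ hd) x).trans h
      · exact abs_apply_le_one_of_polar hf fun φ hφ => by simpa using h hφ
    · rintro _ ⟨φ, hφ, rfl⟩
      simp [hφ.1, e.coord_basis_self]
    · rintro k _ ⟨φ, hφ, rfl⟩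
      simpa [hz0] using e.apply_nonneg hφ.2.1 (hz k)
    · exact (mul_le_mul_of_nonneg_left (hδz k) hc.le).trans (hcn _)
    · exact hw (f.comp (p.toSpaceL : X →L[ℝ] p.Space))
  · refine hp.isWeakStarSuperDaugavetPoint _ ⟨_, e.basis_zero_mem_positiveCap⟩ (fun d hd => hd.1)
      (h := fun n => ‖e.coord (n + 1)‖⁻¹ • e.coord (n + 1)) (fun k d hd => ?_) one_pos
      (fun k => ?_) fun x => e.tendsto_inv_norm_smul_coord x
    · exact mul_nonneg (by positivity) (hd.2.1 _)
    · rw [norm_smul, norm_inv, norm_norm, inv_mul_cancel₀ (norm_ne_zero_iff.2 (e.coord_ne_zero _))]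

/-! ### Positive weakly null sequences -/

theorem tendsto_apply_basis_of_isShrinkingBasis (he : IsShrinkingBasis e) (f : StrongDual ℝ X) :
    Tendsto (fun n => f (‖e n‖⁻¹ • e n)) atTop (𝓝 0) := by
  have hnorm : ∀ n, ‖‖e n‖⁻¹ • e n‖ = 1 := fun n => norm_smul_inv_norm (e.basis_ne_zero n)
  have hspan : ∀ g ∈ Submodule.span ℝ (Set.range e.coord),
      Tendsto (fun n => g (‖e n‖⁻¹ • e n)) atTop (𝓝 0) := by
    intro g hg
    induction hg using Submodule.span_induction with
    | mem g hg =>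
      obtain ⟨m, rfl⟩ := hg
      refine tendsto_const_nhds.congr' ?_
      filter_upwards [eventually_gt_atTop m] with n hn
      rw [map_smul, e.coord_basis_of_ne hn.ne, smul_zero]
    | zero => simp
    | add g h _ _ hg hh =>
      have := hg.add hh
      rw [add_zero] at this
      exact this
    | smul a g _ hg =>
      have := hg.const_mul a
      rw [mul_zero] at this
      exact this
  have hf : f ∈ (Submodule.span ℝ (Set.range e.coord)).topologicalClosure := he ▸ trivial
  rw [Metric.tendsto_atTop]
  intro ε hε
  obtain ⟨g, hg, hfg⟩ := Metric.mem_closure_iff.1 hf (ε / 2) (half_pos hε)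
  obtain ⟨N, hN⟩ := Metric.tendsto_atTop.1 (hspan g hg) (ε / 2) (half_pos hε)
  refine ⟨N, fun n hn => ?_⟩
  have h1 := hN n hn
  have h2 := (f - g).le_opNorm (‖e n‖⁻¹ • e n)
  rw [hnorm, mul_one, sub_apply, ← dist_eq_norm f g] at h2
  rw [Real.dist_eq, sub_zero] at h1 ⊢
  have h3 := abs_sub_abs_le_abs_sub (f (‖e n‖⁻¹ • e n)) (g (‖e n‖⁻¹ • e n))
  rw [Real.norm_eq_abs] at h2
  linarith

theorem exists_superDaugavet_of_isShrinkingBasis [CompleteSpace X] (he : IsShrinkingBasis e) :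
    ∃ p : EquivalentNorm X, (∃ x : p.Space, IsSuperDaugavetPoint x) ∧
      ∃ f : StrongDual ℝ p.Space, IsWeakStarSuperDaugavetPoint f := by
  refine e.exists_superDaugavet_of_positive_weaklyNull
    (z := fun k => ‖e (k + 1)‖⁻¹ • e (k + 1)) (fun k => ?_) (fun k n => ?_) one_pos (fun k => ?_)
    fun f => (tendsto_add_atTop_iff_nat 1).2 (e.tendsto_apply_basis_of_isShrinkingBasis he f)
  · rw [map_smul, e.coord_basis_of_ne (Nat.succ_ne_zero k).symm, smul_zero]
  · rw [map_smul, e.coord_basis]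
    split_ifs <;> simp
  · exact (norm_smul_inv_norm (𝕜 := ℝ) (e.basis_ne_zero _)).ge

theorem exists_superDaugavet_of_not_isBoundedlyCompleteBasis [CompleteSpace X]
    (he : ¬ IsBoundedlyCompleteBasis e) :
    ∃ p : EquivalentNorm X, (∃ x : p.Space, IsSuperDaugavetPoint x) ∧
      ∃ f : StrongDual ℝ p.Space, IsWeakStarSuperDaugavetPoint f := by
  obtain ⟨K, hK1, hK⟩ := e.exists_one_le_norm_proj_le
  have hK0 : 0 < K := by linarith
  unfold IsBoundedlyCompleteBasis at he
  push Not at he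
  obtain ⟨a, ⟨C, hC⟩, hlim⟩ := he
  set S : ℕ → X := fun N => ∑ n ∈ Finset.range N, a n • e n with hS
  have hCS : ∀ N, ‖S N‖ ≤ C := fun N => hC ⟨N, rfl⟩
  have hcS : ∀ N n, e.coord n (S N) = if n ∈ Finset.range N then a n else 0 := by
    intro N n
    simp [hS, e.coord_basis]
  -- The partial sums are bounded but not Cauchy, so there are far blocks of norm at least `δ`.
  have hnc : ¬ CauchySeq S := fun h => by
    obtain ⟨x, hx⟩ := cauchySeq_tendsto_of_complete h
    exact hlim x hx
  rw [Metric.cauchySeq_iff'] at hnc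
  push Not at hnc
  obtain ⟨δ, hδ, hblock⟩ := hnc
  choose m hm hmδ using fun k => hblock (k + 1)
  have hsub : ∀ k, S (m k) - S (k + 1) = ∑ n ∈ Finset.Ico (k + 1) (m k), a n • e n := fun k =>
    (Finset.sum_Ico_eq_sub _ (hm k)).symm
  set z : ℕ → X := fun k => ∑ n ∈ Finset.Ico (k + 1) (m k), |a n| • e n with hz
  have hcz : ∀ k n, e.coord n (z k) = if n ∈ Finset.Ico (k + 1) (m k) then |a n| else 0 := by
    intro k n
    simp only [hz, map_sum, map_smul, e.coord_basis, smul_eq_mul, mul_ite, mul_one,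
      mul_zero, Finset.sum_ite_eq]
  have hfz : ∀ (f : StrongDual ℝ X) k,
      f (z k) = ∑ n ∈ Finset.Ico (k + 1) (m k), |a n| * f (e n) := by
    intro f k
    simp [hz]
  refine e.exists_superDaugavet_of_positive_weaklyNull (z := z) (fun k => ?_) (fun k n => ?_)
    (δ := δ / (2 * K)) (by positivity) (fun k => ?_) fun f => ?_
  · rw [hcz, if_neg (by simp)]
  · rw [hcz]
    split_ifs
    · exact abs_nonneg _
    · exact le_rfl
  · obtain ⟨f, hf1, hfx⟩ := exists_dual_vector'' ℝ (S (m k) - S (k + 1))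
    simp only [RCLike.ofReal_real_eq_id, id] at hfx
    rw [div_le_iff₀ (by positivity)]
    have h1 := hmδ k
    rw [dist_eq_norm, ← hfx, hsub, map_sum] at h1
    have h2 := e.sum_abs_coord_mul_le hK f (Finset.Ico (k + 1) (m k)) (z k)
    have h3 : ∑ n ∈ Finset.Ico (k + 1) (m k), f (a n • e n) ≤
        ∑ n ∈ Finset.Ico (k + 1) (m k), |e.coord n (z k) * f (e n)| := by
      refine Finset.sum_le_sum fun n hn => ?_
      rw [hcz, if_pos hn, abs_mul, abs_abs, ← abs_mul, map_smul]
      exact le_abs_self _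
    nlinarith [norm_nonneg (z k), norm_nonneg f, mul_le_of_le_one_left (norm_nonneg (z k)) hf1]
  · have hsum : Summable fun n => |a n * f (e n)| := by
      refine summable_of_sum_range_le (c := 2 * K * (‖f‖ * C)) (fun n => abs_nonneg _) fun N => ?_
      have h2 := e.sum_abs_coord_mul_le hK f (Finset.range N) (S N)
      have h3 : ∑ n ∈ Finset.range N, |e.coord n (S N) * f (e n)| =
          ∑ n ∈ Finset.range N, |a n * f (e n)| :=
        Finset.sum_congr rfl fun n hn => by rw [hcS, if_pos hn]
      rw [h3] at h2
      refine h2.trans ?_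
      have := hCS N
      gcongr
    have htail := (tendsto_sum_nat_add fun n => |a n * f (e n)|).comp (tendsto_add_atTop_nat 1)
    refine squeeze_zero_norm (fun k => ?_) htail
    rw [hfz, Real.norm_eq_abs, Function.comp_apply]
    refine (Finset.abs_sum_le_sum_abs _ _).trans ?_
    rw [Finset.sum_Ico_eq_sum_range]
    refine le_trans (le_of_eq ?_)
      (((summable_nat_add_iff (k + 1)).2 hsum).sum_le_tsum (Finset.range (m k - (k + 1)))
        fun n _ => abs_nonneg _)
    exact Finset.sum_congr rfl fun n _ => by rw [add_comm, abs_mul, abs_mul, abs_abs]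

end UnconditionalSchauderBasis

end UnconditionalBasis

/-! ### Complemented copies of `ℓ₁` -/

section Telescoping

theorem exists_neg_lt_sub_succ {r : ℕ → ℝ} {C : ℝ} (hr : ∀ n, |r n| ≤ C) {ε : ℝ} (hε : 0 < ε)
    (N : ℕ) : ∃ n, N ≤ n ∧ -ε < r n - r (n + 1) := by
  by_contra! h
  have hgrow : ∀ k : ℕ, r N + k * ε ≤ r (N + k) := by
    intro k
    induction k with
    | zero => simp
    | succ k ih =>
      have := h (N + k) (Nat.le_add_right _ _)
      push_cast
      rw [← add_assoc]
      linarith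
  obtain ⟨k, hk⟩ := exists_nat_gt (2 * C / ε)
  rw [div_lt_iff₀ hε] at hk
  have h1 := (abs_le.1 (hr N)).1
  have h2 := (abs_le.1 (hr (N + k))).2
  linarith [hgrow k]

/-- By summation by parts, the averages of `s n * (r n - r (n + 1))` tend to zero if `r` is bounded
and `s` is bounded and slowly varying, so that not all these numbers are below `-ε`. -/
theorem exists_neg_lt_mul_sub_succ {r s : ℕ → ℝ} {C : ℝ} (hr : ∀ n, |r n| ≤ C)
    (hs : ∀ n, |s n| ≤ 1) (hs' : Tendsto (fun n => s (n + 1) - s n) atTop (𝓝 0)) {ε : ℝ}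
    (hε : 0 < ε) : ∃ n, -ε < s n * (r n - r (n + 1)) := by
  have h0 : Tendsto (fun n => r (n + 1) * (s (n + 1) - s n)) atTop (𝓝 0) :=
    tendsto_mul_zero_of_abs_le (fun n => hr (n + 1)) hs'
  obtain ⟨N, hN⟩ := Metric.tendsto_atTop.1 h0 (ε / 2) (half_pos hε)
  have hb : ∀ n, |s n * r n| ≤ C := fun n => by
    rw [abs_mul]
    exact (mul_le_of_le_one_left (abs_nonneg _) (hs n)).trans (hr n)
  obtain ⟨n, hn, h⟩ := exists_neg_lt_sub_succ hb (half_pos hε) N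
  refine ⟨n, ?_⟩
  have h1 := hN n hn
  rw [Real.dist_eq, sub_zero, abs_lt] at h1
  linarith [h1.1]

end Telescoping

section EllOne

variable {X : Type*} [NormedAddCommGroup X] [NormedSpace ℝ X]

/-- A biorthogonal system that spans a complemented copy of `ℓ₁`: the vectors `u n` are bounded,
and `x ↦ (v n x)` is a bounded operator into `ℓ₁`. -/
structure IsEllOneSystem (u : ℕ → X) (v : ℕ → StrongDual ℝ X) (K : ℝ) : Prop where
  norm_le : ∀ n, ‖u n‖ ≤ K
  apply_eq : ∀ m n, v m (u n) = if m = n then 1 else 0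
  sum_abs_le : ∀ (A : Finset ℕ) x, ∑ n ∈ A, |v n x| ≤ K * ‖x‖

/-- The functional summing the first `n + 1` odd coordinates. -/
def oddPartialSum (v : ℕ → StrongDual ℝ X) (n : ℕ) : StrongDual ℝ X :=
  ∑ j ∈ Finset.range (n + 1), v (2 * j + 1)

/-- The difference of two consecutive odd basis vectors; these differences are biorthogonal to the
functionals `oddPartialSum v n`. -/
def oddDiff (u : ℕ → X) (n : ℕ) : X := u (2 * n + 1) - u (2 * n + 3)

/-- The admissible vectors: small vectors whose odd coordinates have partial sums in `[0, 1]` and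
whose even coordinates are nonnegative. -/
def admissible (v : ℕ → StrongDual ℝ X) : Set X :=
  {y | v 0 y = 0 ∧ ‖y‖ ≤ 1 ∧ (∀ m, 0 ≤ oddPartialSum v m y ∧ oddPartialSum v m y ≤ 1) ∧
    ∀ m, 0 ≤ v (2 * m + 2) y}

/-- The vectors `u 0 + y` with `y` admissible, together with those obtained from them by raising
one of the partial sums of the odd coordinates to its maximal value `1`. -/
def staircaseCap (u : ℕ → X) (v : ℕ → StrongDual ℝ X) : Set X :=
  {d | ∃ y ∈ admissible v, ∃ n, ∃ s : ℝ, (s = 0 ∨ s = 1 - oddPartialSum v n y) ∧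
    d = u 0 + y + s • oddDiff u n}

namespace IsEllOneSystem

variable {u : ℕ → X} {v : ℕ → StrongDual ℝ X} {K : ℝ} (H : IsEllOneSystem u v K)
include H

theorem abs_apply_le (n : ℕ) (x : X) : |v n x| ≤ K * ‖x‖ := by
  simpa using H.sum_abs_le {n} x

theorem one_le : 1 ≤ K := by
  have h0 : 0 ≤ K := (norm_nonneg _).trans (H.norm_le 0)
  have h1 := H.abs_apply_le 0 (u 0)
  rw [H.apply_eq, if_pos rfl, abs_one] at h1
  have h2 := H.norm_le 0
  by_contra! h
  nlinarith [norm_nonneg (u 0)]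

theorem sum_abs_comp_le {σ : ℕ → ℕ} (hσ : Function.Injective σ) (A : Finset ℕ) (x : X) :
    ∑ n ∈ A, |v (σ n) x| ≤ K * ‖x‖ := by
  have := H.sum_abs_le (A.map ⟨σ, hσ⟩) x
  rwa [Finset.sum_map] at this

theorem sum_abs_odd_le (A : Finset ℕ) (x : X) : ∑ n ∈ A, |v (2 * n + 1) x| ≤ K * ‖x‖ :=
  H.sum_abs_comp_le (fun a b h => by simpa using h) A x

theorem sum_abs_even_le (A : Finset ℕ) (x : X) : ∑ n ∈ A, |v (2 * n + 2) x| ≤ K * ‖x‖ :=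
  H.sum_abs_comp_le (fun a b h => by simpa using h) A x

theorem abs_oddPartialSum_le (n : ℕ) (x : X) : |oddPartialSum v n x| ≤ K * ‖x‖ := by
  refine le_trans ?_ (H.sum_abs_odd_le (Finset.range (n + 1)) x)
  rw [oddPartialSum, sum_apply]
  exact Finset.abs_sum_le_sum_abs _ _

theorem oddPartialSum_zero_vec (n : ℕ) : oddPartialSum v n (u 0) = 0 := by
  simp [oddPartialSum, H.apply_eq]

theorem oddPartialSum_even (n m : ℕ) : oddPartialSum v n (u (2 * m + 2)) = 0 := by
  rw [oddPartialSum, sum_apply]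
  refine Finset.sum_eq_zero fun j _ => ?_
  rw [H.apply_eq, if_neg (by omega)]

theorem oddPartialSum_odd (n m : ℕ) :
    oddPartialSum v n (u (2 * m + 1)) = if m ≤ n then 1 else 0 := by
  rw [oddPartialSum, sum_apply]
  simp [H.apply_eq]

theorem oddPartialSum_oddDiff (n m : ℕ) :
    oddPartialSum v n (oddDiff u m) = if m = n then 1 else 0 := by
  rw [oddDiff, map_sub, show 2 * m + 3 = 2 * (m + 1) + 1 by ring, H.oddPartialSum_odd,
    H.oddPartialSum_odd]
  split_ifs <;> first | omega | norm_num

theorem even_oddDiff (n m : ℕ) : v (2 * n) (oddDiff u m) = 0 := by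
  rw [oddDiff, map_sub, H.apply_eq, H.apply_eq, if_neg (by omega), if_neg (by omega), sub_zero]

theorem norm_oddDiff_le (n : ℕ) : ‖oddDiff u n‖ ≤ 2 * K := by
  refine (norm_sub_le _ _).trans ?_
  linarith [H.norm_le (2 * n + 1), H.norm_le (2 * n + 3)]

omit H in
theorem zero_mem_admissible : (0 : X) ∈ admissible v :=
  ⟨by simp, by simp, by simp, by simp⟩

omit H in
theorem add_mem_staircaseCap {y : X} (hy : y ∈ admissible v) : u 0 + y ∈ staircaseCap u v :=
  ⟨y, hy, 0, 0, Or.inl rfl, by simp⟩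

omit H in
theorem zero_vec_mem_staircaseCap : u 0 ∈ staircaseCap u v := by
  simpa using add_mem_staircaseCap (u := u) (zero_mem_admissible (v := v))

theorem apply_zero_of_mem_staircaseCap {d : X} (hd : d ∈ staircaseCap u v) : v 0 d = 1 := by
  obtain ⟨y, hy, n, s, -, rfl⟩ := hd
  have := H.even_oddDiff 0 n
  simp_all [H.apply_eq, hy.1]

theorem even_nonneg_of_mem_staircaseCap {d : X} (hd : d ∈ staircaseCap u v) (m : ℕ) :
    0 ≤ v (2 * m + 2) d := by
  obtain ⟨y, hy, n, s, -, rfl⟩ := hd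
  have := H.even_oddDiff (m + 1) n
  rw [mul_add, mul_one] at this
  simpa [H.apply_eq, this] using hy.2.2.2 m

theorem oddPartialSum_of_mem_staircaseCap {d : X} (hd : d ∈ staircaseCap u v) (m : ℕ) :
    0 ≤ oddPartialSum v m d ∧ oddPartialSum v m d ≤ 1 := by
  obtain ⟨y, hy, n, s, hs, rfl⟩ := hd
  have h1 := hy.2.2.1 m
  rw [map_add, map_add, map_smul, smul_eq_mul, H.oddPartialSum_oddDiff, H.oddPartialSum_zero_vec]
  split_ifs with h
  · subst h
    rcases hs with rfl | rfl
    · simpa using h1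
    · norm_num
  · simpa using h1

theorem norm_le_of_mem_staircaseCap {d : X} (hd : d ∈ staircaseCap u v) : ‖d‖ ≤ 3 * K + 1 := by
  obtain ⟨y, hy, n, s, hs, rfl⟩ := hd
  have hs1 : ‖s‖ ≤ 1 := by
    rcases hs with rfl | rfl
    · simp
    · have := hy.2.2.1 n
      rw [Real.norm_eq_abs, abs_le]
      constructor <;> linarith
  have h1 : ‖s • oddDiff u n‖ ≤ 2 * K := by
    rw [norm_smul]
    exact (mul_le_of_le_one_left (norm_nonneg _) hs1).trans (H.norm_oddDiff_le n)
  have h2 := norm_add_le (u 0 + y) (s • oddDiff u n)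
  have h3 := norm_add_le (u 0) y
  linarith [H.norm_le 0, hy.2.1]

/-- Every small vector of the kernel of `v 0` is a difference of two admissible vectors: add a
multiple of `u 1` to make the partial sums of the odd coordinates nonnegative, and add the absolute
values of the even coordinates. -/
theorem exists_admissible_sub [CompleteSpace X] {y : X} (hy0 : v 0 y = 0)
    (hy : (1 + 2 * K + 2 * K * K) * ‖y‖ ≤ 1) :
    ∃ w, w ∈ admissible v ∧ y + w ∈ admissible v := by
  have hK1 := H.one_le
  have hK0 : 0 ≤ K := by linarith
  have hb : ∀ m, ‖|v (2 * m + 2) y| • u (2 * m + 2)‖ ≤ |v (2 * m + 2) y| * K := fun m => by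
    rw [norm_smul, Real.norm_eq_abs, abs_abs]
    exact mul_le_mul_of_nonneg_left (H.norm_le _) (abs_nonneg _)
  have hs1 : Summable fun m => |v (2 * m + 2) y| :=
    summable_of_sum_le (fun m => abs_nonneg _) fun A => H.sum_abs_even_le A y
  have hs : Summable fun m => |v (2 * m + 2) y| • u (2 * m + 2) :=
    Summable.of_norm_bounded (hs1.mul_right K) hb
  set W : X := ∑' m, |v (2 * m + 2) y| • u (2 * m + 2) with hW
  have hWn : ‖W‖ ≤ K * ‖y‖ * K := by
    refine (tsum_of_norm_bounded (hs1.mul_right K).hasSum hb).trans ?_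
    rw [tsum_mul_right]
    exact mul_le_mul_of_nonneg_right
      (hs1.tsum_le_of_sum_le fun A => H.sum_abs_even_le A y) hK0
  have hWmap : ∀ f : StrongDual ℝ X, f W = ∑' m, |v (2 * m + 2) y| * f (u (2 * m + 2)) := by
    intro f
    rw [hW, f.map_tsum hs]
    simp
  have hW0 : v 0 W = 0 := by
    rw [hWmap]
    simp [H.apply_eq]
  have hWodd : ∀ n, oddPartialSum v n W = 0 := by
    intro n
    rw [hWmap]
    simp [H.oddPartialSum_even]
  have hWeven : ∀ n, v (2 * n + 2) W = |v (2 * n + 2) y| := by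
    intro n
    rw [hWmap, tsum_eq_single n fun m hm => by rw [H.apply_eq, if_neg (by omega), mul_zero],
      H.apply_eq, if_pos rfl, mul_one]
  set c := K * ‖y‖ with hc
  have hc0 : 0 ≤ c := by positivity
  have hw0 : v 0 (W + c • u 1) = 0 := by simp [hW0, H.apply_eq]
  have hwodd : ∀ n, oddPartialSum v n (W + c • u 1) = c := by
    intro n
    have := H.oddPartialSum_odd n 0
    rw [mul_zero, zero_add, if_pos (Nat.zero_le _)] at this
    simp [hWodd, this]
  have hweven : ∀ n, v (2 * n + 2) (W + c • u 1) = |v (2 * n + 2) y| := by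
    intro n
    simp [hWeven, H.apply_eq]
  have hwn : ‖W + c • u 1‖ ≤ 2 * K * K * ‖y‖ := by
    refine (norm_add_le _ _).trans ?_
    rw [norm_smul, Real.norm_of_nonneg hc0]
    have := mul_le_mul_of_nonneg_left (H.norm_le 1) hc0
    rw [hc] at this ⊢
    linarith
  have hy1 : 0 ≤ 2 * K * K * ‖y‖ := by positivity
  refine ⟨W + c • u 1, ⟨hw0, ?_, fun m => ?_, fun m => ?_⟩, ⟨?_, ?_, fun m => ?_, fun m => ?_⟩⟩
  · linarith [norm_nonneg y]
  · rw [hwodd]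
    exact ⟨hc0, by linarith [norm_nonneg y]⟩
  · rw [hweven]
    exact abs_nonneg _
  · rw [map_add, hy0, hw0, add_zero]
  · refine (norm_add_le _ _).trans ?_
    linarith
  · rw [map_add, hwodd]
    have := abs_le.1 (H.abs_oddPartialSum_le m y)
    constructor <;> linarith [norm_nonneg y]
  · rw [map_add, hweven]
    linarith [neg_abs_le (v (2 * m + 2) y)]

theorem exists_norm_le_of_polar [CompleteSpace X] : ∃ C : ℝ, ∀ f : StrongDual ℝ X,
    (∀ d ∈ staircaseCap u v, |f d| ≤ 1) → ‖f‖ ≤ C := by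
  have hK1 := H.one_le
  set M := 1 + 2 * K + 2 * K * K with hM
  have hM0 : 0 < M := by positivity
  set r := (M * (1 + K * K))⁻¹ with hr
  have hr0 : 0 < r := by positivity
  refine ⟨2 * r⁻¹ + K, fun f hf => ?_⟩
  refine ContinuousLinearMap.opNorm_le_of_unit_norm (by positivity) fun x hx => ?_
  have hvx : |v 0 x| ≤ K := by simpa [hx] using H.abs_apply_le 0 x
  have hnx : ‖x - v 0 x • u 0‖ ≤ 1 + K * K := by
    refine (norm_sub_le _ _).trans ?_
    rw [hx, norm_smul]
    exact add_le_add le_rfl (mul_le_mul hvx (H.norm_le 0) (norm_nonneg _) (by linarith))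
  obtain ⟨w, hw, hyw⟩ := H.exists_admissible_sub (y := r • (x - v 0 x • u 0))
    (by simp [H.apply_eq]) (by
      rw [norm_smul, Real.norm_of_nonneg hr0.le, ← hM, hr, mul_inv]
      have h1 : (0 : ℝ) < 1 + K * K := by positivity
      calc M * (M⁻¹ * (1 + K * K)⁻¹ * ‖x - v 0 x • u 0‖)
          = (1 + K * K)⁻¹ * ‖x - v 0 x • u 0‖ := by field_simp
        _ ≤ 1 := by rwa [inv_mul_le_iff₀ h1, mul_one])
  have h1 := abs_le.1 (hf _ (add_mem_staircaseCap hw))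
  have h2 := abs_le.1 (hf _ (add_mem_staircaseCap hyw))
  have h0 := hf _ zero_vec_mem_staircaseCap
  rw [map_add] at h1
  rw [map_add, map_add, map_smul, map_sub, map_smul, smul_eq_mul, smul_eq_mul] at h2
  have h3 : |r * (f x - v 0 x * f (u 0))| ≤ 2 := by
    rw [abs_le]
    constructor <;> linarith [h1.1, h1.2, h2.1, h2.2]
  rw [abs_mul, abs_of_pos hr0, ← le_inv_mul_iff₀ hr0] at h3
  have h4 : |v 0 x * f (u 0)| ≤ K := by
    rw [abs_mul]
    exact (mul_le_of_le_one_right (abs_nonneg _) h0).trans hvx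
  have h5 := abs_sub_abs_le_abs_sub (f x) (v 0 x * f (u 0))
  rw [Real.norm_eq_abs]
  linarith

/-- Raising the `n`-th partial sum of the odd coordinates of `y` to `1` costs arbitrarily little in
the direction of a given functional, for a suitable `n`. Although `oddDiff u` is not weakly null,
its sums telescope, so that its averages tend to zero. -/
theorem exists_neg_lt_apply_oddDiff {y : X} (hy : y ∈ admissible v) (f : StrongDual ℝ X) {ε : ℝ}
    (hε : 0 < ε) : ∃ n, -ε < (1 - oddPartialSum v n y) * f (oddDiff u n) := by
  have hsum : Summable fun n => |v (2 * n + 1) y| :=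
    summable_of_sum_le (fun m => abs_nonneg _) fun A => H.sum_abs_odd_le A y
  have h0 : Tendsto (fun n => v (2 * n + 1) y) atTop (𝓝 0) :=
    (tendsto_zero_iff_abs_tendsto_zero _).2 hsum.tendsto_atTop_zero
  have hr : ∀ n, |f (u (2 * n + 1))| ≤ ‖f‖ * K := fun n =>
    (f.le_opNorm _).trans (mul_le_mul_of_nonneg_left (H.norm_le _) (norm_nonneg _))
  have hs : ∀ n, |1 - oddPartialSum v n y| ≤ 1 := by
    intro n
    have := hy.2.2.1 n
    rw [abs_le]
    constructor <;> linarith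
  have hs' : Tendsto (fun n => (1 - oddPartialSum v (n + 1) y) - (1 - oddPartialSum v n y)) atTop
      (𝓝 0) := by
    have h1 := ((tendsto_add_atTop_iff_nat 1).2 h0).neg
    rw [neg_zero] at h1
    refine h1.congr fun n => ?_
    rw [oddPartialSum, oddPartialSum, Finset.sum_range_succ _ (n + 1), add_apply]
    ring
  obtain ⟨n, hn⟩ := exists_neg_lt_mul_sub_succ hr hs hs' hε
  refine ⟨n, ?_⟩
  rwa [oddDiff, map_sub]

/-- A slice of the unit ball contains a point `d` of `staircaseCap u v` or of its opposite. In the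
second case `v 0` separates `u 0` from `d` by `2`. In the first case `d` may be chosen such that
some partial sum of its odd coordinates is `1`, and then `v 0 - 2 • oddPartialSum v n` does. -/
theorem isDaugavetPoint {p : EquivalentNorm X} (hp : IsPolarNorm p (staircaseCap u v)) :
    IsDaugavetPoint (p.toSpaceL (u 0)) := by
  have htpolar : ∀ d ∈ staircaseCap u v, |v 0 d| ≤ 1 := fun d hd => by
    rw [H.apply_zero_of_mem_staircaseCap hd, abs_one]
  have hv0 : v 0 (u 0) = 1 := by rw [H.apply_eq, if_pos rfl]
  have hone : ‖p.toSpaceL (u 0)‖ = 1 := by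
    refine (hp.norm_toSpaceL_le_one zero_vec_mem_staircaseCap).antisymm ?_
    have := hp.abs_le (v 0) htpolar (u 0)
    rwa [hv0, abs_one] at this
  refine ⟨hone, fun F α hF hα => isLUB_norm_sub_image hone (fun y hy => hy.1) fun ε hε => ?_⟩
  set f : StrongDual ℝ X := F.comp (p.toSpaceL : X →L[ℝ] p.Space) with hf
  suffices h : ∃ d : X, ‖p.toSpaceL d‖ ≤ 1 ∧ 1 - α < f d ∧ 2 ≤ ‖p.toSpaceL (u 0 - d)‖ by
    obtain ⟨d, hd1, hd2, hd3⟩ := h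
    refine ⟨p.toSpaceL d, ⟨hd1, hd2⟩, ?_⟩
    rw [← map_sub]
    linarith
  -- A positive slice height is needed in order to rescale `F` by its inverse.
  obtain ⟨β, hβ0, hβ1, hβα⟩ : ∃ β : ℝ, 0 < β ∧ β < 1 ∧ 1 - α ≤ β :=
    ⟨max (1 - α) (1 / 2), lt_max_of_lt_right (by norm_num), max_lt (by linarith) (by norm_num),
      le_max_left _ _⟩
  obtain ⟨d, hd, hfd⟩ : ∃ d ∈ staircaseCap u v, β < |f d| := by
    by_contra! hcon
    have h1 : ‖β⁻¹ • F‖ ≤ 1 := (hp.norm_dual_le_one_iff _).2 fun d hd => by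
      rw [smul_apply, smul_eq_mul, abs_mul, abs_of_pos (inv_pos.2 hβ0), inv_mul_le_iff₀ hβ0,
        mul_one]
      exact hcon d hd
    rw [norm_smul, hF, mul_one, Real.norm_of_nonneg (inv_pos.2 hβ0).le] at h1
    exact absurd ((one_lt_inv₀ hβ0).2 hβ1) (not_lt.2 h1)
  rcases lt_or_ge (f d) 0 with hneg | hpos
  · rw [abs_of_neg hneg] at hfd
    refine ⟨-d, ?_, by rw [map_neg]; linarith, ?_⟩
    · rw [map_neg, norm_neg]
      exact hp.norm_toSpaceL_le_one hd
    · have := hp.abs_le (v 0) htpolar (u 0 - -d)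
      rw [map_sub, map_neg, hv0, H.apply_zero_of_mem_staircaseCap hd] at this
      norm_num at this
      rw [sub_neg_eq_add, ← p.norm_toSpaceL] at *
      exact this
  · rw [abs_of_nonneg hpos] at hfd
    obtain ⟨y, hy, n, hfn⟩ : ∃ y ∈ admissible v, ∃ n,
        β < f (u 0 + y + (1 - oddPartialSum v n y) • oddDiff u n) := by
      obtain ⟨y, hy, n, s, rfl | rfl, rfl⟩ := hd
      · obtain ⟨n, hn⟩ := H.exists_neg_lt_apply_oddDiff hy f (sub_pos.2 hfd)
        refine ⟨y, hy, n, ?_⟩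
        rw [zero_smul, add_zero] at hn
        rw [map_add _ (u 0 + y), map_smul, smul_eq_mul]
        linarith
      · exact ⟨y, hy, n, hfd⟩
    refine ⟨_, hp.norm_toSpaceL_le_one ⟨y, hy, n, _, Or.inr rfl, rfl⟩, by linarith, ?_⟩
    have := hp.abs_le (v 0 - (2 : ℝ) • oddPartialSum v n) (fun d hd => ?_)
      (u 0 - (u 0 + y + (1 - oddPartialSum v n y) • oddDiff u n))
    · refine le_trans (le_of_eq ?_) this
      have hz := H.even_oddDiff 0 n
      rw [mul_zero] at hz
      simp only [sub_apply, smul_apply, map_sub, map_add, map_smul, smul_eq_mul, hv0, hy.1, hz,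
        H.oddPartialSum_oddDiff, H.oddPartialSum_zero_vec, if_true]
      ring_nf
      norm_num
    · have := H.oddPartialSum_of_mem_staircaseCap hd n
      rw [sub_apply, smul_apply, smul_eq_mul, H.apply_zero_of_mem_staircaseCap hd, abs_le]
      constructor <;> linarith

/-- The odd coordinates serve the Daugavet point of the space; the even coordinate functionals,
which are nonnegative on `staircaseCap u v` and weakly null in the dual, serve that of the dual. -/
theorem exists_daugavet [CompleteSpace X] : ∃ p : EquivalentNorm X,
    (∃ x : p.Space, IsDaugavetPoint x) ∧ ∃ f : StrongDual ℝ p.Space, IsDaugavetPoint f := by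
  have hK1 := H.one_le
  obtain ⟨C, hC⟩ := H.exists_norm_le_of_polar
  obtain ⟨p, hp⟩ := exists_isPolarNorm (fun d hd => H.norm_le_of_mem_staircaseCap hd) hC
  refine ⟨p, ⟨_, H.isDaugavetPoint hp⟩, ⟨p.functional (v 0), ?_⟩⟩
  refine (hp.isSuperDaugavetPoint_dual (v 0) ⟨_, zero_vec_mem_staircaseCap⟩
    (fun d hd => H.apply_zero_of_mem_staircaseCap hd) (h := fun n => v (2 * n + 2))
    (fun k d hd => H.even_nonneg_of_mem_staircaseCap hd k) (δ := K⁻¹) (by positivity)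
    (fun k => ?_) (K := K) (by linarith) H.sum_abs_even_le).isDaugavetPoint
  rw [inv_le_iff_one_le_mul₀ (by linarith)]
  have h1 := (v (2 * k + 2)).le_opNorm (u (2 * k + 2))
  rw [H.apply_eq, if_pos rfl, norm_one] at h1
  exact h1.trans (mul_le_mul_of_nonneg_left (H.norm_le _) (norm_nonneg _))

end IsEllOneSystem

/-- A functional outside the closed span of the coordinate functionals does not decay along the
blocks of an unconditional basis; it norms a block sequence equivalent to the basis of `ℓ₁`, whose
span it complements by its restrictions to the blocks. -/
theorem UnconditionalSchauderBasis.exists_isEllOneSystem [CompleteSpace X]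
    (e : UnconditionalSchauderBasis ℕ ℝ X) (he : ¬ IsShrinkingBasis e) :
    ∃ (u : ℕ → X) (v : ℕ → StrongDual ℝ X) (K : ℝ), IsEllOneSystem u v K := by
  obtain ⟨K, hK1, hK⟩ := e.exists_one_le_norm_proj_le
  obtain ⟨f, hf⟩ : ∃ f : StrongDual ℝ X,
      f ∉ (Submodule.span ℝ (Set.range e.coord)).topologicalClosure := by
    by_contra! h
    exact he (eq_top_iff.2 fun f _ => h f)
  obtain ⟨δ, hδ, hfar⟩ : ∃ δ : ℝ, 0 < δ ∧
      ∀ g ∈ Submodule.span ℝ (Set.range e.coord), δ ≤ dist f g := by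
    by_contra! h
    exact hf (Metric.mem_closure_iff.2 h)
  -- Beyond each `N` there is a block vector `u` with `f u = 1`, of norm bounded uniformly in `N`.
  have hblock : ∀ N : ℕ, ∃ M, N ≤ M ∧ ∃ u : X, ‖u‖ ≤ K * (δ / 2)⁻¹ ∧ f u = 1 ∧
      e.proj (Finset.Ico N M) u = u := by
    intro N
    have hmem : f.comp (e.proj (Finset.range N)) ∈ Submodule.span ℝ (Set.range e.coord) := by
      have : f.comp (e.proj (Finset.range N)) = ∑ n ∈ Finset.range N, f (e n) • e.coord n := by
        ext x
        simp [mul_comm]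
      rw [this]
      exact Submodule.sum_mem _ fun n _ => Submodule.smul_mem _ _ (Submodule.subset_span ⟨n, rfl⟩)
    have h1 := hfar _ hmem
    rw [dist_eq_norm] at h1
    obtain ⟨x, hx1, hx⟩ := (f - f.comp (e.proj (Finset.range N))).exists_lt_apply_of_lt_opNorm
      (r := δ / 2) (by linarith)
    have hlim : Tendsto (fun M => ‖f (e.proj (Finset.range M) x) -
        f (e.proj (Finset.range N) x)‖) atTop
        (𝓝 ‖f x - f (e.proj (Finset.range N) x)‖) :=
      (((e.tendsto_apply_proj f x).comp tendsto_finset_range).sub_const _).norm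
    obtain ⟨M, hNM, hM⟩ :=
      ((eventually_ge_atTop N).and (hlim.eventually (lt_mem_nhds hx))).exists
    have hIco : f (e.proj (Finset.Ico N M) x) =
        f (e.proj (Finset.range M) x) - f (e.proj (Finset.range N) x) := by
      rw [e.apply_proj, e.apply_proj, e.apply_proj, Finset.sum_Ico_eq_sub _ hNM]
    rw [← hIco] at hM
    have hpos : 0 < ‖f (e.proj (Finset.Ico N M) x)‖ := (half_pos hδ).trans hM
    refine ⟨M, hNM, (f (e.proj (Finset.Ico N M) x))⁻¹ • e.proj (Finset.Ico N M) x, ?_, ?_, ?_⟩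
    · rw [norm_smul, norm_inv, mul_comm]
      refine mul_le_mul ?_ ?_ (by positivity) (by linarith)
      · refine ((e.proj _).le_of_opNorm_le (hK _) x).trans ?_
        exact mul_le_of_le_one_right (by linarith) hx1.le
      · exact inv_anti₀ (half_pos hδ) hM.le
    · rw [map_smul, smul_eq_mul, inv_mul_cancel₀ (norm_pos_iff.1 hpos)]
    · rw [map_smul, e.proj_proj, Finset.inter_self]
  choose M hM u hu hfu hpu using hblock
  set N : ℕ → ℕ := fun k => M^[k] 0 with hN
  have hNs : ∀ k, N (k + 1) = M (N k) := fun k => Function.iterate_succ_apply' M k 0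
  have hmono : Monotone N := monotone_nat_of_le_succ fun k => by
    rw [hNs]
    exact hM _
  have hdisj : ∀ k l, k ≠ l →
      Disjoint (Finset.Ico (N k) (N (k + 1))) (Finset.Ico (N l) (N (l + 1))) := by
    intro k l hkl
    rw [← Finset.disjoint_coe, Finset.coe_Ico, Finset.coe_Ico]
    exact hmono.pairwise_disjoint_on_Ico_succ hkl
  set B : ℝ := max (K * (δ / 2)⁻¹) (2 * K * ‖f‖) with hB
  refine ⟨fun k => u (N k), fun k => f.comp (e.proj (Finset.Ico (N k) (N (k + 1)))), B,
    fun k => (hu _).trans (le_max_left _ _), fun k l => ?_, fun A x => ?_⟩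
  · have hl : e.proj (Finset.Ico (N l) (N (l + 1))) (u (N l)) = u (N l) := by
      rw [hNs]
      exact hpu _
    rw [ContinuousLinearMap.comp_apply]
    split_ifs with hkl
    · rw [hkl, hl, hfu]
    · rw [← hl, e.proj_proj, Finset.disjoint_iff_inter_eq_empty.1 (hdisj k l hkl)]
      simp
  · calc ∑ k ∈ A, |(f.comp (e.proj (Finset.Ico (N k) (N (k + 1))))) x|
        ≤ ∑ k ∈ A, ∑ n ∈ Finset.Ico (N k) (N (k + 1)), |e.coord n x * f (e n)| := by
          refine Finset.sum_le_sum fun k _ => ?_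
          rw [ContinuousLinearMap.comp_apply, e.apply_proj]
          exact Finset.abs_sum_le_sum_abs _ _
      _ = ∑ n ∈ A.biUnion fun k => Finset.Ico (N k) (N (k + 1)), |e.coord n x * f (e n)| :=
          (Finset.sum_biUnion fun k _ l _ hkl => hdisj k l hkl).symm
      _ ≤ 2 * K * (‖f‖ * ‖x‖) := e.sum_abs_coord_mul_le hK f _ x
      _ ≤ B * ‖x‖ := by
          rw [← mul_assoc]
          exact mul_le_mul_of_nonneg_right (le_max_right _ _) (norm_nonneg _)

end EllOne

theorem corollary4p14 {X : Type*} [NormedAddCommGroup X] [NormedSpace ℝ X] [CompleteSpace X]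
    (e : UnconditionalSchauderBasis ℕ ℝ X) :
    (∃ p : EquivalentNorm X, ∃ x : p.Space, IsDaugavetPoint x) ∧
    ((IsShrinkingBasis e ∨ (¬ IsShrinkingBasis e ∧ ¬ IsBoundedlyCompleteBasis e)) →
      ∃ p : EquivalentNorm X,
        (∃ x : p.Space, IsSuperDaugavetPoint x) ∧
        (∃ f : StrongDual ℝ p.Space, IsWeakStarSuperDaugavetPoint f)) ∧
    (¬ IsShrinkingBasis e →
      ∃ p : EquivalentNorm X,
        (∃ x : p.Space, IsDaugavetPoint x) ∧
        (∃ f : StrongDual ℝ p.Space, IsDaugavetPoint f)) := by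
  have hshr := e.exists_superDaugavet_of_isShrinkingBasis
  have hnshr : ¬ IsShrinkingBasis e → ∃ p : EquivalentNorm X,
      (∃ x : p.Space, IsDaugavetPoint x) ∧ ∃ f : StrongDual ℝ p.Space, IsDaugavetPoint f := by
    intro he
    obtain ⟨u, v, K, H⟩ := e.exists_isEllOneSystem he
    exact H.exists_daugavet
  refine ⟨?_, ?_, hnshr⟩
  · by_cases he : IsShrinkingBasis e
    · obtain ⟨p, ⟨x, hx⟩, -⟩ := hshr he
      exact ⟨p, x, hx.isDaugavetPoint⟩
    · obtain ⟨p, ⟨x, hx⟩, -⟩ := hnshr he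
      exact ⟨p, x, hx⟩
  · rintro (he | ⟨-, he⟩)
    · exact hshr he
    · exact e.exists_superDaugavet_of_not_isBoundedlyCompleteBasis he
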